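/- Let $M$ be a compact smooth 3-manifold without boundary. For a smooth Riemannian metric $g$ on $M$ let $R_{ij}$ and $R$ be the Ricci tensor and the scalar curvature (positive on round spheres), $S_{ij}=R_{ij}-\tfrac14 R\,g_{ij}$ the Schouten tensor, $S=g^{ij}S_{ij}=R/4$ its trace, and $\Delta=g^{ij}\nabla_i\nabla_j$. Set $$H_{ij}=3S^k{}_iS_{kj}-g_{ij}S_{kl}S^{kl}-\Delta S_{ij}+\nabla_i\nabla_jS,\qquad J_{ij}=S^k{}_iS_{kj}-S\,S_{ij}+\tfrac12 g_{ij}\,(S^2-S_{kl}S^{kl}),$$ and $K_{ij}=2J_{ij}+2H_{ij}$. The $K$-flow is $\partial_t g_{ij}=-K_{ij}$. A soliton of the $K$-flow is a pair $(g,X)$ of a smooth Riemannian metric $g$ and a smooth vector field $X$ on $M$ with $\mathcal L_Xg=K$, that is, $\nabla_iX_j+\nabla_jX_i=K_{ij}$. 1. If $(g,X)$ is a soliton of the $K$-flow on $M$, then $$\int_M|\mathcal L_Xg|_g^2\,d\mu_g=0,$$ where $\mu_g$ is the Riemannian volume measure. Moreover $\mathcal L_Xg=0$, i.e. $X$ is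 a Killing vector field, and $K_{ij}=0$. Thus every soliton is trivial. 2. Flat metrics give such trivial solitons: if the Riemann tensor of $g$ vanishes, then $K_{ij}=0$, and for a smooth vector field $X$ the pair $(g,X)$ is a soliton if and only if $X$ is Killing. -/

import Mathlib

open scoped Manifold ContDiff
open MeasureTheory

noncomputable section

namespace KFlow

/-- The coordinate space `ℝ³`. -/
abbrev E3 : Type := EuclideanSpace ℝ (Fin 3)

/-- The partial derivative `∂ᵢ f`. -/
def pd (i : Fin 3) (f : E3 → ℝ) (y : E3) : ℝ :=
  fderiv ℝ f y (EuclideanSpace.single i 1)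

/-! ### Riemannian geometry in a coordinate domain of `ℝ³`

`G y i j = g_{ij}(y)` are the components of a metric; `T y i j = T_{ij}(y)` those of a covariant
2-tensor. The inverse metric `g^{ij}` is the inverse matrix `(G y)⁻¹ i j`. -/

/-- Christoffel symbols `Γᵏᵢⱼ = ½ g^{kl} (∂ᵢ g_{jl} + ∂ⱼ g_{il} - ∂ₗ g_{ij})`. -/
def christoffel (G : E3 → Matrix (Fin 3) (Fin 3) ℝ) (k i j : Fin 3) (y : E3) : ℝ :=
  (1 / 2) * ∑ l, (G y)⁻¹ k l *
    (pd i (fun z => G z j l) y + pd j (fun z => G z i l) y - pd l (fun z => G z i j) y)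

/-- Riemann tensor `R_{ijk}{}^l`, with the sign fixed by `[∇ᵢ, ∇ⱼ] w_k = R_{ijk}{}^l w_l`. -/
def riemann (G : E3 → Matrix (Fin 3) (Fin 3) ℝ) (i j k l : Fin 3) (y : E3) : ℝ :=
  pd j (christoffel G l i k) y - pd i (christoffel G l j k) y
    + ∑ m, (christoffel G m i k y * christoffel G l j m y
        - christoffel G m j k y * christoffel G l i m y)

/-- Ricci tensor `R_{ij} = R_{ikj}{}^k = R^k{}_{ikj}` (positive on round spheres). -/
def ricci (G : E3 → Matrix (Fin 3) (Fin 3) ℝ) (y : E3) : Matrix (Fin 3) (Fin 3) ℝ :=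
  Matrix.of fun i j => ∑ k, riemann G i k j k y

/-- Scalar curvature `R = g^{ij} R_{ij}`. -/
def scalar (G : E3 → Matrix (Fin 3) (Fin 3) ℝ) (y : E3) : ℝ :=
  ∑ i, ∑ j, (G y)⁻¹ i j * ricci G y i j

/-- Schouten tensor `S_{ij} = R_{ij} - ¼ g_{ij} R`. -/
def schouten (G : E3 → Matrix (Fin 3) (Fin 3) ℝ) (y : E3) : Matrix (Fin 3) (Fin 3) ℝ :=
  Matrix.of fun i j => ricci G y i j - (1 / 4) * G y i j * scalar G y

/-- The trace `S = R / 4` of the Schouten tensor. -/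
def schoutenTr (G : E3 → Matrix (Fin 3) (Fin 3) ℝ) (y : E3) : ℝ := scalar G y / 4

/-- `S^k{}_i S_{kj}`. -/
def schoutenSq (G : E3 → Matrix (Fin 3) (Fin 3) ℝ) (y : E3) : Matrix (Fin 3) (Fin 3) ℝ :=
  Matrix.of fun i j => ∑ k, ∑ l, (G y)⁻¹ k l * schouten G y l i * schouten G y k j

/-- `S_{kl} S^{kl}`. -/
def schoutenNormSq (G : E3 → Matrix (Fin 3) (Fin 3) ℝ) (y : E3) : ℝ :=
  ∑ i, ∑ j, (G y)⁻¹ i j * schoutenSq G y i j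

/-- First covariant derivative `∇ₖ T_{ij}` of a covariant 2-tensor. -/
def covD (G T : E3 → Matrix (Fin 3) (Fin 3) ℝ) (k i j : Fin 3) (y : E3) : ℝ :=
  pd k (fun z => T z i j) y
    - ∑ n, christoffel G n k i y * T y n j - ∑ n, christoffel G n k j y * T y i n

/-- Second covariant derivative `∇ₗ ∇ₖ T_{ij}` of a covariant 2-tensor. -/
def covD2 (G T : E3 → Matrix (Fin 3) (Fin 3) ℝ) (l k i j : Fin 3) (y : E3) : ℝ :=
  pd l (covD G T k i j) y
    - ∑ n, christoffel G n l k y * covD G T n i j y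
    - ∑ n, christoffel G n l i y * covD G T k n j y
    - ∑ n, christoffel G n l j y * covD G T k i n y

/-- Rough Laplacian `Δ T_{ij} = g^{lk} ∇ₗ ∇ₖ T_{ij}`. -/
def laplacian (G T : E3 → Matrix (Fin 3) (Fin 3) ℝ) (y : E3) : Matrix (Fin 3) (Fin 3) ℝ :=
  Matrix.of fun i j => ∑ l, ∑ k, (G y)⁻¹ l k * covD2 G T l k i j y

/-- Hessian `∇ᵢ ∇ⱼ f` of a function. -/
def hessian (G : E3 → Matrix (Fin 3) (Fin 3) ℝ) (f : E3 → ℝ) (y : E3) :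
    Matrix (Fin 3) (Fin 3) ℝ :=
  Matrix.of fun i j => pd i (pd j f) y - ∑ k, christoffel G k i j y * pd k f y

/-- `H_{ij} = 3 S^k{}_i S_{kj} - g_{ij} S_{kl} S^{kl} - Δ S_{ij} + ∇ᵢ ∇ⱼ S`. -/
def tensorH (G : E3 → Matrix (Fin 3) (Fin 3) ℝ) (y : E3) : Matrix (Fin 3) (Fin 3) ℝ :=
  Matrix.of fun i j => 3 * schoutenSq G y i j - G y i j * schoutenNormSq G y
    - laplacian G (schouten G) y i j + hessian G (schoutenTr G) y i j

/-- `J_{ij} = S^k{}_i S_{kj} - S S_{ij} + ½ g_{ij} (S² - S_{kl} S^{kl})`. -/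
def tensorJ (G : E3 → Matrix (Fin 3) (Fin 3) ℝ) (y : E3) : Matrix (Fin 3) (Fin 3) ℝ :=
  Matrix.of fun i j => schoutenSq G y i j - schoutenTr G y * schouten G y i j
    + (1 / 2) * G y i j * (schoutenTr G y ^ 2 - schoutenNormSq G y)

/-- The `K`-tensor `K_{ij} = 2 J_{ij} + 2 H_{ij}`. -/
def tensorK (G : E3 → Matrix (Fin 3) (Fin 3) ℝ) (y : E3) : Matrix (Fin 3) (Fin 3) ℝ :=
  Matrix.of fun i j => 2 * tensorJ G y i j + 2 * tensorH G y i j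

/-- Lie derivative of the metric: `(ℒ_X g)_{ij} = Xᵏ ∂ₖ g_{ij} + g_{kj} ∂ᵢ Xᵏ + g_{ik} ∂ⱼ Xᵏ`. -/
def lieMetric (G : E3 → Matrix (Fin 3) (Fin 3) ℝ) (X : E3 → Fin 3 → ℝ) (y : E3) :
    Matrix (Fin 3) (Fin 3) ℝ :=
  Matrix.of fun i j => ∑ k, (X y k * pd k (fun z => G z i j) y
    + G y k j * pd i (fun z => X z k) y + G y i k * pd j (fun z => X z k) y)

/-- `|T|² = g^{ik} g^{jl} T_{ij} T_{kl}`. -/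
def normSq (G T : Matrix (Fin 3) (Fin 3) ℝ) : ℝ :=
  ∑ i, ∑ j, ∑ k, ∑ l, G⁻¹ i k * G⁻¹ j l * T i j * T k l

/-! ### Smooth 3-manifolds -/

section Manifold

variable (M : Type*) [TopologicalSpace M] [ChartedSpace E3 M] [IsManifold (𝓡 3) ∞ M]

/-- Smooth Riemannian metrics on `M`. -/
abbrev Metric : Type _ :=
  Bundle.ContMDiffRiemannianMetric (𝓡 3) ∞ E3 (fun x : M => TangentSpace (𝓡 3) x)

variable {M}

/-- Components `g_{ij} = g(∂ᵢ, ∂ⱼ)` of a metric in a chart `e`, as functions on `e.target`. -/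
def metricCoeff (g : Metric M) (e : OpenPartialHomeomorph M E3) (y : E3) :
    Matrix (Fin 3) (Fin 3) ℝ :=
  Matrix.of fun i j =>
    g.inner (e.symm y)
      (mfderiv (𝓡 3) (𝓡 3) e.symm y (EuclideanSpace.single i (1 : ℝ) : E3))
      (mfderiv (𝓡 3) (𝓡 3) e.symm y (EuclideanSpace.single j (1 : ℝ) : E3))

/-- Components `Xⁱ = dxⁱ(X)` of a vector field in a chart `e`, as functions on `e.target`. -/
def vectorCoeff (X : (x : M) → TangentSpace (𝓡 3) x) (e : OpenPartialHomeomorph M E3) (y : E3)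
    (i : Fin 3) : ℝ :=
  let v : E3 := mfderiv (𝓡 3) (𝓡 3) e (e.symm y) (X (e.symm y))
  v i

/-- Components of `ℒ_X g` in a chart. -/
def lieCoeff (g : Metric M) (X : (x : M) → TangentSpace (𝓡 3) x)
    (e : OpenPartialHomeomorph M E3) : E3 → Matrix (Fin 3) (Fin 3) ℝ :=
  lieMetric (metricCoeff g e) (vectorCoeff X e)

/-- Components of the `K`-tensor of `g` in a chart. -/
def kCoeff (g : Metric M) (e : OpenPartialHomeomorph M E3) : E3 → Matrix (Fin 3) (Fin 3) ℝ :=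
  tensorK (metricCoeff g e)

/-- `(g, X)` is a soliton of the `K`-flow: `ℒ_X g = K`, i.e. `(ℒ_X g)_{ij} = K_{ij}` in all smooth
local coordinates. -/
def IsKSoliton (g : Metric M) (X : (x : M) → TangentSpace (𝓡 3) x) : Prop :=
  ∀ e ∈ IsManifold.maximalAtlas (𝓡 3) ∞ M, ∀ y ∈ e.target, lieCoeff g X e y = kCoeff g e y

/-- `X` is a Killing vector field of `g`: `ℒ_X g = 0`. -/
def IsKilling (g : Metric M) (X : (x : M) → TangentSpace (𝓡 3) x) : Prop :=
  ∀ e ∈ IsManifold.maximalAtlas (𝓡 3) ∞ M, ∀ y ∈ e.target, lieCoeff g X e y = 0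

/-- The `K`-tensor of `g` vanishes: `K_{ij} = 0`. -/
def KVanishes (g : Metric M) : Prop :=
  ∀ e ∈ IsManifold.maximalAtlas (𝓡 3) ∞ M, ∀ y ∈ e.target, kCoeff g e y = 0

/-- `g` is flat: its Riemann tensor vanishes. -/
def IsFlat (g : Metric M) : Prop :=
  ∀ e ∈ IsManifold.maximalAtlas (𝓡 3) ∞ M, ∀ y ∈ e.target, ∀ i j k l,
    riemann (metricCoeff g e) i j k l y = 0

/-- The function `|ℒ_X g|²` on `M`, evaluated at `p` in the preferred chart at `p` (the value does
not depend on the chart). -/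
def lieNormSq (g : Metric M) (X : (x : M) → TangentSpace (𝓡 3) x) (p : M) : ℝ :=
  normSq (metricCoeff g (chartAt E3 p) (chartAt E3 p p))
    (lieCoeff g X (chartAt E3 p) (chartAt E3 p p))

section Volume

variable [T2Space M] [SigmaCompactSpace M] [MeasurableSpace M]

variable (M) in
/-- A smooth partition of unity subordinate to the preferred charts. -/
def chartPartition : SmoothPartitionOfUnity M (𝓡 3) M Set.univ :=
  (SmoothPartitionOfUnity.exists_isSubordinate_chartAt_source (𝓡 3) M).choose

/-- The Riemannian volume measure `dμ = √(det g) dx¹dx²dx³`, glued from the charts with a smooth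
partition of unity: `∫ f dμ = ∑ₚ ∫ (ρₚ f)(x) √(det g(x)) dx`, the `p`-th integral in the chart
at `p`. The result does not depend on the partition. -/
def riemannianVolume (g : Metric M) : Measure M :=
  Measure.sum fun p : M =>
    Measure.map (chartAt E3 p).symm
      (((volume : Measure E3).restrict (chartAt E3 p).target).withDensity fun y =>
        ENNReal.ofReal (chartPartition M p ((chartAt E3 p).symm y) *
          Real.sqrt (metricCoeff g (chartAt E3 p) y).det))

end Volume

end Manifold

end KFlow

end

/-!
The tensor `K` is divergence free, and this forces every soliton on a compact manifold to be
trivial. Indeed, if `ℒ_X g = K`, then the vector field `Yⁱ = Kⁱⱼ Xʲ` satisfies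
`div Y = K^{ij} ∇ᵢ Xⱼ = ½ ⟨K, ℒ_X g⟩ = ½ |ℒ_X g|²`, and the integral of a divergence vanishes. The
integrand is continuous and non-negative, so `ℒ_X g = 0`, and then `K = ℒ_X g = 0`. If the Riemann
tensor vanishes, so do all ingredients of `K`, and the second part follows.

That `K` is divergence free rests on the Cotton tensor `C_{kij} = ∇ₖ S_{ij} - ∇ᵢ S_{kj}`. In
dimension three the Riemann tensor is an algebraic expression in the Schouten tensor
(`FormalMetric.Rm_eq`), so that the Ricci identity and the contracted Bianchi identity give
`H_{ij} = -∇^k C_{kij}` (`FormalMetric.H_eq`). As `C` is skew in its first two indices,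
`∇^i ∇^k C_{kij}` is a contraction of curvature with `C`, namely `S^{kl} C_{kjl}`
(`FormalMetric.divUp_H`). The Bianchi identity also gives `∇^i (2 J_{ij}) = 2 S^{kl} C_{kjl}`
(`FormalMetric.divUp_J2`), and the two contributions to the divergence of `K = 2 J + 2 H` cancel
(`FormalMetric.divUp_K`).

These computations are carried out in a commutative algebra with three commuting derivations, where
they are polynomial identities and no question of differentiability arises. They apply to the
algebra of smooth functions on `ℝ³`, hence to metrics on all of `ℝ³`. Since the divergence of `K` at
a point depends only on the germ of the metric, and a metric on an open set can be extended from a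
neighbourhood of any point with the help of a cutoff function, they apply in every chart
(`tensorK_div`), and there give the formula for `div Y` (`div_flux`).

The global part avoids a divergence theorem on manifolds. For a smooth function `u` with support in
a chart, integration by parts in that chart gives `∫ u |ℒ_X g|² = -2 ∫ Y(u)`
(`integral_mul_lieNormSq`). Summing over a partition of unity `ρ` and inserting `1 = ∑ₚ ρₚ` leaves
the integrals of `ρₚ Y(ρ_q)`. Such an integral may be computed in the chart `p` as well as in the
chart `q`, and in the chart `p` the sum over `q` vanishes because `∑_q ρ_q = 1`
(`sum_integral_eq_zero`). The chart independence uses that `ℒ_X g` is a tensor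
(`lieMetric_transform`); the tensoriality of `K` is never needed, since the soliton equation holds
in all charts.
-/

noncomputable section

namespace KFlow

/-! ### Formal tensor calculus in dimension three -/

/-- A three-dimensional Riemannian metric over a commutative `ℝ`-algebra `A` with three commuting
derivations, which plays the role of the algebra of smooth functions of three coordinates. The
Christoffel symbols are data, tied to the metric by the two properties characterizing the
Levi-Civita connection. No positivity is asked for: the tensor identities do not need it. -/
structure FormalMetric (A : Type*) [CommRing A] [Algebra ℝ A] where
  /-- The partial derivative `∂ᵢ`. -/
  d : Fin 3 → Derivation ℝ A A
  /-- The metric `g_{ij}`. -/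
  g : Fin 3 → Fin 3 → A
  /-- The inverse metric `g^{ij}`. -/
  h : Fin 3 → Fin 3 → A
  /-- The Christoffel symbols `Γᵏᵢⱼ`, the upper index first. -/
  Γ : Fin 3 → Fin 3 → Fin 3 → A
  d_comm : ∀ i j a, d i (d j a) = d j (d i a)
  g_symm : ∀ i j, g i j = g j i
  h_symm : ∀ i j, h i j = h j i
  h_mul_g : ∀ i j, ∑ k, h i k * g k j = if i = j then 1 else 0
  /-- The connection is torsion free. -/
  Γ_symm : ∀ k i j, Γ k i j = Γ k j i
  /-- The connection is metric: `∇ₖ g_{ij} = 0`. -/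
  d_g : ∀ k i j, d k (g i j) = ∑ n, Γ n k i * g n j + ∑ n, Γ n k j * g i n

namespace FormalMetric

variable {A : Type*} [CommRing A] [Algebra ℝ A] (L : FormalMetric A)

theorem eq_zero_of_two_mul {a : A} (ha : 2 * a = 0) : a = 0 := by
  have : (2 : ℝ) • a = 0 := by rw [two_smul, ← two_mul, ha]
  simpa using this

/-- Raising an index and lowering it again: `g^{ib} g_{bj} Q_i = Q_j`. -/
theorem sum_h_g (j : Fin 3) (Q : Fin 3 → A) :
    ∑ i, ∑ b, L.h i b * (L.g b j * Q i) = Q j := by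
  have h1 : ∀ i, ∑ b, L.h i b * (L.g b j * Q i) = (if i = j then 1 else 0) * Q i := by
    intro i
    rw [← L.h_mul_g, Finset.sum_mul]
    exact Finset.sum_congr rfl fun b _ => by ring
  simp [h1]

theorem g_mul_h (i j : Fin 3) : ∑ k, L.g i k * L.h k j = if i = j then 1 else 0 := by
  rw [if_congr (eq_comm (a := i) (b := j)) rfl rfl, ← L.h_mul_g]
  exact Finset.sum_congr rfl fun k _ => by rw [L.g_symm, L.h_symm]; ring

/-- The inverse metric is parallel: `∇ₖ g^{ij} = 0`. -/
theorem d_h (k i j : Fin 3) :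
    L.d k (L.h i j) = -∑ n, L.Γ i k n * L.h n j - ∑ n, L.Γ j k n * L.h i n := by
  have key : ∀ b, ∑ a, L.d k (L.h i a) * L.g a b
      = -∑ a, L.h i a * L.d k (L.g a b) := by
    intro b
    have := congrArg (L.d k) (L.h_mul_g i b)
    have h0 : L.d k (if i = b then (1 : A) else 0) = 0 := by split_ifs <;> simp
    rw [h0, map_sum] at this
    simp only [Derivation.leibniz, smul_eq_mul, Finset.sum_add_distrib] at this
    rw [eq_neg_iff_add_eq_zero, ← this, add_comm]
    congr 1
    exact Finset.sum_congr rfl fun _ _ => by ring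
  have e1 : L.d k (L.h i j) = ∑ b, (∑ a, L.d k (L.h i a) * L.g a b) * L.h b j := by
    simp only [Finset.sum_mul]
    rw [Finset.sum_comm]
    simp only [mul_assoc, ← Finset.mul_sum, L.g_mul_h]
    simp
  have e2 : ∀ n, ∑ b, L.g n b * L.h b j = if n = j then 1 else 0 := fun n => L.g_mul_h n j
  have e3 : ∀ n, ∑ a, L.h i a * L.g a n = if i = n then 1 else 0 := fun n => L.h_mul_g i n
  rw [e1]
  simp only [key, L.d_g]
  have e4 : ∑ n, L.Γ j k n * L.h i n
      = ∑ a, ∑ n, L.h i a * L.Γ n k a * (∑ b, L.g n b * L.h b j) := by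
    simp only [e2]; simp; exact Finset.sum_congr rfl fun _ _ => by ring
  have e5 : ∑ n, L.Γ i k n * L.h n j
      = ∑ b, ∑ n, (∑ a, L.h i a * L.g a n) * L.Γ n k b * L.h b j := by
    simp only [e3]; simp
  rw [e4, e5]
  simp only [Fin.sum_univ_three]
  ring

/-- The Riemann tensor `R_{ijk}{}^l`, with the sign fixed by `[∇ᵢ, ∇ⱼ] w_k = R_{ijk}{}^l w_l`. -/
def Rm (i j k l : Fin 3) : A :=
  L.d j (L.Γ l i k) - L.d i (L.Γ l j k)
    + ∑ m, (L.Γ m i k * L.Γ l j m - L.Γ m j k * L.Γ l i m)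

/-- The Ricci tensor. -/
def Ric (i j : Fin 3) : A := ∑ k, L.Rm i k j k

/-- A quarter of the scalar curvature, which is the trace `S` of the Schouten tensor in dimension
three. -/
def s : A := (1 / 4 : ℝ) • ∑ i, ∑ j, L.h i j * L.Ric i j

/-- The Schouten tensor `S_{ij}`. -/
def S (i j : Fin 3) : A := L.Ric i j - L.g i j * L.s

/-- Covariant derivative `∇ₖ T_{ij}`. -/
def cov (T : Fin 3 → Fin 3 → A) (k i j : Fin 3) : A :=
  L.d k (T i j) - ∑ n, L.Γ n k i * T n j - ∑ n, L.Γ n k j * T i n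

/-- Covariant derivative `∇ₗ W_{kij}`. -/
def cov3 (W : Fin 3 → Fin 3 → Fin 3 → A) (l k i j : Fin 3) : A :=
  L.d l (W k i j) - ∑ n, L.Γ n l k * W n i j - ∑ n, L.Γ n l i * W k n j
    - ∑ n, L.Γ n l j * W k i n

/-- The defining scalar `1/4` lives in `ℝ`; this is the form usable in ring arithmetic over `A`. -/
theorem four_mul_s : 4 * L.s = ∑ i, ∑ j, L.h i j * L.Ric i j := by
  rw [s, mul_smul_comm, ← smul_mul_assoc]
  have : ((1 / 4 : ℝ) • (4 : A)) = 1 := by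
    have : (4 : A) = algebraMap ℝ A 4 := (map_ofNat _ 4).symm
    rw [this, Algebra.smul_def, ← map_mul]; norm_num
  rw [this, one_mul]

theorem Rm_antisymm (i j k l : Fin 3) : L.Rm i j k l = -L.Rm j i k l := by
  simp only [Rm, Fin.sum_univ_three]; ring

theorem bianchi_first (i j k l : Fin 3) :
    L.Rm i j k l + L.Rm j k i l + L.Rm k i j l = 0 := by
  simp only [Rm, Fin.sum_univ_three, fun m => L.Γ_symm m k i, fun m => L.Γ_symm m j i,
    fun m => L.Γ_symm m k j]
  ring

/-- The curvature operator `R_{ij}{}^{lm}` with both bundle indices raised. -/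
def curvOp (l m i j : Fin 3) : A := ∑ k, L.h k m * L.Rm i j k l

/-- `R_{ij}{}^{lm}` is skew in `l, m`: apply `[∂ᵢ, ∂ⱼ] = 0` to the parallel tensor `g^{lm}`. -/
theorem curvOp_antisymm_up (l m i j : Fin 3) : L.curvOp l m i j = -L.curvOp m l i j := by
  have h1 := L.d_comm i j (L.h l m)
  rw [L.d_h j, L.d_h i] at h1
  simp only [Fin.sum_univ_three, map_sub, map_neg, map_add, Derivation.leibniz, smul_eq_mul,
    L.d_h] at h1
  simp only [curvOp, Rm, Fin.sum_univ_three, L.h_symm l 0, L.h_symm l 1, L.h_symm l 2,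
    L.h_symm 1 0, L.h_symm 2 0, L.h_symm 2 1] at h1 ⊢
  linear_combination h1

theorem curvOp_antisymm_down (l m i j : Fin 3) : L.curvOp l m i j = -L.curvOp l m j i := by
  simp only [curvOp, L.Rm_antisymm i j, mul_neg, Finset.sum_neg_distrib]

theorem Rm_eq_sum_curvOp (i j k l : Fin 3) : L.Rm i j k l = ∑ m, L.g k m * L.curvOp l m i j := by
  simp only [curvOp, Finset.mul_sum]
  rw [Finset.sum_comm]
  have : ∀ n, ∑ m, L.g k m * (L.h n m * L.Rm i j n l)
      = (if k = n then 1 else 0) * L.Rm i j n l := fun n => by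
    rw [← L.g_mul_h, Finset.sum_mul]
    exact Finset.sum_congr rfl fun m _ => by rw [L.h_symm m n]; ring
  simp [this]

theorem trace_Rm (i j : Fin 3) : ∑ k, L.Rm i j k k = 0 := by
  apply eq_zero_of_two_mul
  simp only [L.Rm_eq_sum_curvOp, Fin.sum_univ_three, L.g_symm 1 0, L.g_symm 2 0, L.g_symm 2 1]
  linear_combination L.g 0 0 * L.curvOp_antisymm_up 0 0 i j + L.g 1 1 * L.curvOp_antisymm_up 1 1 i j
    + L.g 2 2 * L.curvOp_antisymm_up 2 2 i j + 2 * L.g 0 1 * L.curvOp_antisymm_up 0 1 i j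
    + 2 * L.g 0 2 * L.curvOp_antisymm_up 0 2 i j + 2 * L.g 1 2 * L.curvOp_antisymm_up 1 2 i j

theorem Ric_symm (i j : Fin 3) : L.Ric i j = L.Ric j i := by
  have h1 := L.trace_Rm i j
  have h2 := fun k => L.bianchi_first i j k k
  simp only [Ric, Fin.sum_univ_three] at h1 ⊢
  linear_combination h1 - h2 0 - h2 1 - h2 2 + L.Rm_antisymm 0 i j 0 + L.Rm_antisymm 1 i j 1
    + L.Rm_antisymm 2 i j 2

theorem S_symm (i j : Fin 3) : L.S i j = L.S j i := by
  rw [S, S, L.Ric_symm, L.g_symm]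

/-- The mixed Schouten tensor `S_i{}^m`. -/
def Sm (i m : Fin 3) : A := ∑ k, L.S i k * L.h k m

/-- The contraction `R_{il}{}^{lm}` is the Ricci tensor with one index raised. -/
theorem sum_curvOp (i m : Fin 3) :
    ∑ l, L.curvOp l m i l = L.Sm i m + (if i = m then 1 else 0) * L.s := by
  rw [← L.g_mul_h, Sm]
  simp only [curvOp, S, Ric]
  rw [Finset.sum_comm, Finset.sum_mul, ← Finset.sum_add_distrib]
  refine Finset.sum_congr rfl fun k _ => ?_
  rw [← Finset.mul_sum]
  ring

theorem four_mul_s_eq_trace_curvOp : 4 * L.s = ∑ i, ∑ l, L.curvOp l i i l := by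
  rw [four_mul_s]
  refine Finset.sum_congr rfl fun i _ => ?_
  simp only [curvOp, Ric]
  rw [Finset.sum_comm]
  refine Finset.sum_congr rfl fun k _ => ?_
  rw [← Finset.mul_sum, L.h_symm]

/-- In dimension three the curvature operator is determined by the Schouten tensor. -/
theorem curvOp_eq (l m i j : Fin 3) : L.curvOp l m i j =
    L.Sm i m * (if j = l then 1 else 0) + L.Sm j l * (if i = m then 1 else 0)
      - L.Sm i l * (if j = m then 1 else 0) - L.Sm j m * (if i = l then 1 else 0) := by
  have hs := L.four_mul_s_eq_trace_curvOp
  have e := fun i m => eq_sub_of_add_eq (L.sum_curvOp i m).symm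
  have up := L.curvOp_antisymm_up
  have dn := L.curvOp_antisymm_down
  -- By skew-symmetry only the nine components `R_{ij}{}^{lm}` with `i < j` and `l < m` are left;
  -- the nine contractions `R_{il}{}^{lm}` determine each of them.
  have u0 : ∀ l i j, L.curvOp l l i j = 0 := fun l i j =>
    eq_zero_of_two_mul (by linear_combination up l l i j)
  have d0 : ∀ l m i, L.curvOp l m i i = 0 := fun l m i =>
    eq_zero_of_two_mul (by linear_combination dn l m i i)
  have t : 2 * L.s = -(L.curvOp 0 1 0 1 + L.curvOp 0 2 0 2 + L.curvOp 1 2 1 2) := by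
    rw [← sub_eq_zero]
    apply eq_zero_of_two_mul
    simp only [Fin.sum_univ_three, u0, up 1 0, up 2 0, up 2 1, dn _ _ 1 0, dn _ _ 2 0,
      dn _ _ 2 1] at hs
    linear_combination hs
  simp only [e, Fin.sum_univ_three]
  fin_cases l <;> fin_cases m <;> fin_cases i <;> fin_cases j <;>
    simp [u0, d0, up 1 0, up 2 0, up 2 1, dn _ _ 1 0, dn _ _ 2 0, dn _ _ 2 1] <;>
    first | ring1 | linear_combination t | linear_combination -t

/-! ### Bianchi identities and the Cotton tensor -/

theorem sum_Sm_g (i k : Fin 3) : ∑ m, L.Sm i m * L.g m k = L.S i k := by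
  simp only [Sm, Finset.sum_mul]
  rw [Finset.sum_comm]
  simp only [mul_assoc, ← Finset.mul_sum, L.h_mul_g]
  simp

/-- The decomposition of the curvature tensor in dimension three, where the Weyl tensor vanishes:
`R_{ijk}{}^l` is the Kulkarni–Nomizu product of the Schouten tensor and the metric. -/
theorem Rm_eq (i j k l : Fin 3) : L.Rm i j k l =
    L.S i k * (if j = l then 1 else 0) + L.Sm j l * L.g i k
      - L.Sm i l * L.g j k - L.S j k * (if i = l then 1 else 0) := by
  have e : ∀ i m, L.Sm i m * L.g k m = L.Sm i m * L.g m k := fun i m => by rw [L.g_symm]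
  rw [L.Rm_eq_sum_curvOp, ← L.sum_Sm_g i k, ← L.sum_Sm_g j k]
  simp only [L.curvOp_eq, mul_add, mul_sub, Finset.sum_add_distrib, Finset.sum_sub_distrib,
    Finset.sum_mul]
  simp only [mul_ite, mul_one, mul_zero, Finset.sum_ite_eq, Finset.mem_univ, if_true,
    L.g_symm k]
  simp only [Finset.sum_ite_irrel, Finset.sum_const_zero]
  split_ifs <;> simp [mul_comm]

/-- The curvature tensor contracted with a covector `T_m`, in terms of the Schouten tensor. -/
theorem sum_Rm_mul (l i k : Fin 3) (T : Fin 3 → A) :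
    ∑ m, L.Rm l i k m * T m = L.S l k * T i + (∑ m, L.Sm i m * T m) * L.g l k
      - (∑ m, L.Sm l m * T m) * L.g i k - L.S i k * T l := by
  have : ∀ m, L.Rm l i k m * T m = L.S l k * ((if i = m then 1 else 0) * T m)
      + L.Sm i m * T m * L.g l k - L.Sm l m * T m * L.g i k
      - L.S i k * ((if l = m then 1 else 0) * T m) := fun m => by rw [L.Rm_eq]; ring
  simp only [this, Finset.sum_add_distrib, Finset.sum_sub_distrib, ← Finset.mul_sum,
    ← Finset.sum_mul]
  simp

/-- The second Bianchi identity. The connection terms acting on the antisymmetrized indices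
`m, i, j` cancel and are left out. -/
theorem bianchi_second (m i j k l : Fin 3) :
    (L.d m (L.Rm i j k l) - ∑ n, L.Γ n m k * L.Rm i j n l + ∑ n, L.Γ l m n * L.Rm i j k n)
    + (L.d i (L.Rm j m k l) - ∑ n, L.Γ n i k * L.Rm j m n l + ∑ n, L.Γ l i n * L.Rm j m k n)
    + (L.d j (L.Rm m i k l) - ∑ n, L.Γ n j k * L.Rm m i n l + ∑ n, L.Γ l j n * L.Rm m i k n)
    = 0 := by
  simp only [Rm, Fin.sum_univ_three, map_add, map_sub, Derivation.leibniz, smul_eq_mul,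
    L.d_comm j i, L.d_comm m i, L.d_comm j m]
  ring

theorem sum_Rm_g (i j k l : Fin 3) : ∑ n, L.Rm i j k n * L.g n l =
    L.S i k * L.g j l + L.S j l * L.g i k - L.S i l * L.g j k - L.S j k * L.g i l := by
  rw [L.sum_Rm_mul, L.sum_Sm_g, L.sum_Sm_g]

/-- Covariant differentiation commutes with the metric trace. -/
theorem cov_trace (T : Fin 3 → Fin 3 → A) (j : Fin 3) :
    ∑ i, ∑ k, L.h i k * L.cov T j i k = L.d j (∑ i, ∑ k, L.h i k * T i k) := by
  simp only [cov, Fin.sum_univ_three, map_add, Derivation.leibniz, smul_eq_mul, L.d_h]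
  ring

theorem sum_h_g_self : ∑ i, ∑ k, L.h i k * L.g i k = 3 := by
  have : ∀ i, ∑ k, L.h i k * L.g i k = 1 := fun i => by
    simpa [L.g_symm] using L.h_mul_g i i
  simp [this]

theorem trace_S : ∑ i, ∑ k, L.h i k * L.S i k = L.s := by
  have h1 := L.four_mul_s
  have h2 := L.sum_h_g_self
  simp only [S, Fin.sum_univ_three] at h1 h2 ⊢
  linear_combination -h1 - L.s * h2

theorem cov_S_symm (m i j : Fin 3) : L.cov L.S m i j = L.cov L.S m j i := by
  simp only [cov, L.S_symm j i, Fin.sum_univ_three]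
  linear_combination -L.Γ 0 m i * L.S_symm 0 j - L.Γ 1 m i * L.S_symm 1 j
    - L.Γ 2 m i * L.S_symm 2 j + L.Γ 0 m j * L.S_symm 0 i + L.Γ 1 m j * L.S_symm 1 i
    + L.Γ 2 m j * L.S_symm 2 i

/-- The second Bianchi identity with `Rm_eq` inserted: the cyclic sum over `m, i, j` of
`∇_m (S_{ik} g_{jl} + S_{jl} g_{ik} - S_{il} g_{jk} - S_{jk} g_{il})` vanishes. -/
theorem bianchi_S (m i j k l : Fin 3) :
    (L.cov L.S m i k * L.g j l + L.cov L.S m j l * L.g i k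
      - L.cov L.S m i l * L.g j k - L.cov L.S m j k * L.g i l)
    + (L.cov L.S i j k * L.g m l + L.cov L.S i m l * L.g j k
      - L.cov L.S i j l * L.g m k - L.cov L.S i m k * L.g j l)
    + (L.cov L.S j m k * L.g i l + L.cov L.S j i l * L.g m k
      - L.cov L.S j m l * L.g i k - L.cov L.S j i k * L.g m l) = 0 := by
  have key : ∀ m i j, ∑ p, (L.d m (L.Rm i j k p) - ∑ n, L.Γ n m k * L.Rm i j n p
        + ∑ n, L.Γ p m n * L.Rm i j k n) * L.g p l
      = L.d m (∑ p, L.Rm i j k p * L.g p l) - ∑ n, L.Γ n m k * (∑ p, L.Rm i j n p * L.g p l)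
        - ∑ n, L.Γ n m l * (∑ p, L.Rm i j k p * L.g p n) := by
    intro m i j
    simp only [Fin.sum_univ_three, map_add, Derivation.leibniz, smul_eq_mul, L.d_g]
    ring
  have h0 : ∑ p, ((L.d m (L.Rm i j k p) - ∑ n, L.Γ n m k * L.Rm i j n p
        + ∑ n, L.Γ p m n * L.Rm i j k n) * L.g p l
      + (L.d i (L.Rm j m k p) - ∑ n, L.Γ n i k * L.Rm j m n p
        + ∑ n, L.Γ p i n * L.Rm j m k n) * L.g p l
      + (L.d j (L.Rm m i k p) - ∑ n, L.Γ n j k * L.Rm m i n p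
        + ∑ n, L.Γ p j n * L.Rm m i k n) * L.g p l) = 0 := by
    refine Finset.sum_eq_zero fun p _ => ?_
    rw [← add_mul, ← add_mul, L.bianchi_second, zero_mul]
  rw [Finset.sum_add_distrib, Finset.sum_add_distrib, key, key, key] at h0
  simp only [L.sum_Rm_g, Fin.sum_univ_three, map_add, map_sub, Derivation.leibniz, smul_eq_mul,
    L.d_g] at h0
  simp only [cov, Fin.sum_univ_three, fun n => L.Γ_symm n j i, fun n => L.Γ_symm n m i,
    fun n => L.Γ_symm n j m] at h0 ⊢
  linear_combination h0

/-- Contracted Bianchi identity `∇^i S_{ij} = ∇_j S`. -/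
theorem div_S (j : Fin 3) : ∑ i, ∑ k, L.h i k * L.cov L.S i k j = L.d j L.s := by
  -- Tracing the second Bianchi identity once leaves the claim multiplied by the metric; tracing
  -- again over `i, k` gives `3 A_j = A_j` for the difference `A_j` of the two sides.
  have x0 : ∀ i j k, (∑ a, ∑ b, L.h a b * L.cov L.S a b j - L.d j L.s) * L.g i k
      = (∑ a, ∑ b, L.h a b * L.cov L.S a b i - L.d i L.s) * L.g j k := by
    intro i j k
    have tr := fun j => L.cov_trace L.S j
    simp only [L.trace_S] at tr
    have c0 : ∑ m, ∑ l, L.h m l * ((L.cov L.S m i k * L.g j l + L.cov L.S m j l * L.g i k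
      - L.cov L.S m i l * L.g j k - L.cov L.S m j k * L.g i l)
    + (L.cov L.S i j k * L.g m l + L.cov L.S i m l * L.g j k
      - L.cov L.S i j l * L.g m k - L.cov L.S i m k * L.g j l)
    + (L.cov L.S j m k * L.g i l + L.cov L.S j i l * L.g m k
      - L.cov L.S j m l * L.g i k - L.cov L.S j i k * L.g m l)) = 0 := by
      simp only [L.bianchi_S, mul_zero, Finset.sum_const_zero]
    have a2 := L.sum_h_g_self
    rw [← tr i, ← tr j]
    have a3 : ∀ j (Q : Fin 3 → A), ∑ m, ∑ l, L.h m l * (L.g j l * Q m) = Q j := fun j Q => by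
      rw [← L.sum_h_g j Q]; simp only [L.g_symm j]
    have a4 : ∀ j (Q : Fin 3 → A), ∑ m, ∑ l, L.h m l * (L.g m j * Q l) = Q j := fun j Q => by
      rw [← L.sum_h_g j Q, Finset.sum_comm]; simp only [fun a b => L.h_symm a b]
    have b1 := a3 j (fun m => L.cov L.S m i k)
    have b2 := a3 i (fun m => L.cov L.S m j k)
    have b3 := a4 k (fun l => L.cov L.S i j l)
    have b4 := a3 j (fun m => L.cov L.S i m k)
    have b5 := a3 i (fun m => L.cov L.S j m k)
    have b6 := a4 k (fun l => L.cov L.S j i l)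
    simp only [Fin.sum_univ_three, L.cov_S_symm _ j, L.cov_S_symm _ i] at c0 b1 b2 b3 b4 b5 b6 a2 ⊢
    linear_combination c0 - b1 + b2 + b3 + b4 - b5 - b6 - L.cov L.S i k j * a2
      + L.cov L.S j k i * a2
  rw [← sub_eq_zero]
  apply eq_zero_of_two_mul
  have x1 := L.sum_h_g_self
  have x2 := L.sum_h_g j fun i => ∑ a, ∑ b, L.h a b * L.cov L.S a b i - L.d i L.s
  have x3 : ∑ i, ∑ k, L.h i k * ((∑ a, ∑ b, L.h a b * L.cov L.S a b j - L.d j L.s) * L.g i k)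
      = ∑ i, ∑ k, L.h i k *
        (L.g k j * (∑ a, ∑ b, L.h a b * L.cov L.S a b i - L.d i L.s)) :=
    Finset.sum_congr rfl fun i _ => Finset.sum_congr rfl fun k _ => by
      rw [x0 i j k, L.g_symm k j]; ring
  have x4 : ∑ i, ∑ k, L.h i k * ((∑ a, ∑ b, L.h a b * L.cov L.S a b j - L.d j L.s) * L.g i k)
      = (∑ a, ∑ b, L.h a b * L.cov L.S a b j - L.d j L.s) * 3 := by
    rw [← x1]
    simp only [Finset.mul_sum]
    exact Finset.sum_congr rfl fun i _ => Finset.sum_congr rfl fun k _ => by ring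
  rw [x2, x4] at x3
  linear_combination x3

/-! ### The tensors `H` and `J` -/

/-- `S^k{}_i S_{kj}`. -/
def Sq (i j : Fin 3) : A := ∑ k, ∑ l, L.h k l * L.S l i * L.S k j

/-- `S_{kl} S^{kl}`. -/
def nS : A := ∑ i, ∑ j, L.h i j * L.Sq i j

/-- The rough Laplacian `Δ T_{ij}`. -/
def lap (T : Fin 3 → Fin 3 → A) (i j : Fin 3) : A :=
  ∑ l, ∑ k, L.h l k * L.cov3 (L.cov T) l k i j

/-- The Hessian `∇ᵢ ∇ⱼ f`. -/
def hess (f : A) (i j : Fin 3) : A := L.d i (L.d j f) - ∑ k, L.Γ k i j * L.d k f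

/-- The tensor `H`. -/
def H (i j : Fin 3) : A :=
  3 * L.Sq i j - L.g i j * L.nS - L.lap L.S i j + L.hess L.s i j

/-- Twice the tensor `J`. -/
def J2 (i j : Fin 3) : A :=
  2 * (L.Sq i j - L.s * L.S i j) + L.g i j * (L.s ^ 2 - L.nS)

/-- The Cotton tensor `C_{kij} = ∇ₖ S_{ij} - ∇ᵢ S_{kj}`. -/
def C (k i j : Fin 3) : A := L.cov L.S k i j - L.cov L.S i k j

/-- The Ricci identity for a covariant 2-tensor: the commutator of covariant derivatives is
the curvature acting on each index. -/
theorem ricci_identity (T : Fin 3 → Fin 3 → A) (l i k j : Fin 3) :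
    L.cov3 (L.cov T) l i k j - L.cov3 (L.cov T) i l k j
      = ∑ m, L.Rm l i k m * T m j + ∑ m, L.Rm l i j m * T k m := by
  simp only [cov3, cov, Rm, Fin.sum_univ_three, map_add, map_sub, Derivation.leibniz, smul_eq_mul,
    L.d_comm i l, fun m => L.Γ_symm m l i]
  ring

/-- Covariant differentiation commutes with a metric trace of a covariant 3-tensor. -/
theorem cov3_trace (W : Fin 3 → Fin 3 → Fin 3 → A) (i j : Fin 3) :
    ∑ l, ∑ k, L.h l k * L.cov3 W i l k j
      = L.d i (∑ l, ∑ k, L.h l k * W l k j)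
        - ∑ n, L.Γ n i j * ∑ l, ∑ k, L.h l k * W l k n := by
  simp only [cov3, Fin.sum_univ_three, map_add, Derivation.leibniz, smul_eq_mul, L.d_h]
  ring

theorem sum_Sm_S (i j : Fin 3) : ∑ m, L.Sm i m * L.S m j = L.Sq i j := by
  simp only [Sm, Sq, Finset.sum_mul]
  refine Finset.sum_congr rfl fun k _ => Finset.sum_congr rfl fun m _ => ?_
  rw [L.S_symm i, L.h_symm]
  ring

/-- `H_{ij} = -∇^k C_{kij}`: commuting the derivatives in `∇^k ∇ᵢ S_{kj}` turns it into
`∇ᵢ ∇^k S_{kj} = ∇ᵢ ∇ⱼ S`, and by `Rm_eq` the curvature terms that appear are the quadratic terms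
of `H`. -/
theorem H_eq (i j : Fin 3) : L.H i j = -∑ l, ∑ k, L.h l k * L.cov3 L.C l k i j := by
  have e1 : ∀ l k, L.cov3 L.C l k i j = L.cov3 (L.cov L.S) l k i j
      - L.cov3 (L.cov L.S) i l k j - (∑ m, L.Rm l i k m * L.S m j + ∑ m,
        L.Rm l i j m * L.S k m) := by
    intro l k
    rw [← L.ricci_identity]
    simp only [cov3, C, Fin.sum_univ_three, map_sub]
    ring
  have e2 := L.cov3_trace (L.cov L.S) i j
  -- The contracted Bianchi identity turns `∇ᵢ ∇^k S_{kj}` into `∇ᵢ ∇ⱼ S`.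
  simp only [L.div_S] at e2
  have e3 : ∀ l k, L.h l k * L.cov3 L.C l k i j = L.h l k * L.cov3 (L.cov L.S) l k i j
      - L.h l k * L.cov3 (L.cov L.S) i l k j
      - (L.h l k * L.S l k * L.S i j + L.h l k * L.g l k * L.Sq i j
        - L.h l k * (L.g i k * L.Sq l j) - L.h l k * L.S l j * L.S i k
        + L.h l k * L.S l j * L.S i k + L.h l k * (L.g l j * L.Sq i k)
        - L.h l k * L.Sq l k * L.g i j - L.h l k * L.S l k * L.S i j) := by
    intro l k
    have f1 : ∑ m, L.Rm l i j m * L.S k m = ∑ m, L.Rm l i j m * L.S m k :=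
      Finset.sum_congr rfl fun m _ => by rw [L.S_symm]
    rw [e1, f1, L.sum_Rm_mul, L.sum_Rm_mul]
    simp only [L.sum_Sm_S]
    ring
  have e4 := L.sum_h_g_self
  have a3 : ∑ l, ∑ k, L.h l k * (L.g i k * L.Sq l j) = L.Sq i j := by
    rw [← L.sum_h_g i fun l => L.Sq l j]; simp only [L.g_symm i]
  have a4 : ∑ l, ∑ k, L.h l k * (L.g l j * L.Sq i k) = L.Sq i j := by
    rw [← L.sum_h_g j fun k => L.Sq i k, Finset.sum_comm]; simp only [fun a b => L.h_symm a b]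
  simp only [e3, Finset.sum_add_distrib, Finset.sum_sub_distrib, ← Finset.sum_mul, e4, a3, a4, e2]
  rw [H, lap, hess, nS]
  ring

/-- The divergence `∇ᵢ Fⁱⱼ` of a mixed tensor field, with the contracted Christoffel symbol `Γⁿₙᵢ`
written first. -/
def divUp (F : Fin 3 → Fin 3 → A) (j : Fin 3) : A :=
  ∑ i, (L.d i (F i j) + (∑ n, L.Γ n n i) * F i j - ∑ l, L.Γ l i j * F i l)

/-- The divergence of a covariant 2-tensor may be taken before or after its first index is
raised. -/
theorem divUp_raise (T : Fin 3 → Fin 3 → A) (j : Fin 3) :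
    L.divUp (fun i j => ∑ b, L.h i b * T b j) j = ∑ i, ∑ b, L.h i b * L.cov T i b j := by
  simp only [divUp, cov, Fin.sum_univ_three, map_add, Derivation.leibniz, smul_eq_mul, L.d_h]
  ring

/-- The Cotton tensor `C^{ki}{}_j` with its two antisymmetric indices raised. -/
def Cup (k i j : Fin 3) : A := ∑ a, ∑ b, L.h k a * L.h i b * L.C a b j

/-- `∇ₖ C^{ki}{}_j = -H^i{}_j`. The divergence treats `i` as a label: the connection term
`Γⁱₖₙ C^{kn}{}_j` it omits vanishes, `C` being skew and `Γ` symmetric. -/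
theorem divUp_Cup (i j : Fin 3) :
    L.divUp (fun k j => L.Cup k i j) j = -∑ b, L.h i b * L.H b j := by
  simp only [L.H_eq]
  simp only [divUp, Cup, cov3, C, Fin.sum_univ_three, map_add, map_sub, Derivation.leibniz,
    smul_eq_mul, L.d_h, fun n => L.Γ_symm n 1 0, fun n => L.Γ_symm n 2 0, fun n => L.Γ_symm n 2 1]
  ring

theorem Cup_antisymm (k i j : Fin 3) : L.Cup k i j = -L.Cup i k j := by
  simp only [Cup, C, Fin.sum_univ_three]
  ring

/-- The one-form `Γⁿₙᵢ` is closed; it is the differential of `log √(det g)`. -/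
theorem d_trace_Γ (i j : Fin 3) :
    L.d j (∑ n, L.Γ n n i) = L.d i (∑ n, L.Γ n n j) := by
  have := L.trace_Rm i j
  simp only [Rm, Fin.sum_univ_three, map_add, fun n => L.Γ_symm n i, fun n => L.Γ_symm n j]
    at this ⊢
  linear_combination this

/-- The double divergence of a tensor that is skew in its two contracted indices is a curvature
term: `2 ∇ᵢ ∇ₖ F^{ki}{}_j = R_{ikj}{}^l F^{ki}{}_l`. The curvature terms of the upper indices drop
out by the symmetry of the Ricci tensor, which enters as `d_trace_Γ`. -/
theorem divUp_divUp (F : Fin 3 → Fin 3 → Fin 3 → A) (hF : ∀ k i j, F k i j = -F i k j)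
    (j : Fin 3) :
    2 * L.divUp (fun i j => L.divUp (fun k j => F k i j) j) j
      = ∑ i, ∑ k, ∑ l, L.Rm i k j l * F k i l := by
  have F0 : ∀ i j, F i i j = 0 := fun i j =>
    eq_zero_of_two_mul (by linear_combination hF i i j)
  have t := L.d_trace_Γ
  simp only [divUp, Rm]
  generalize hτ : (fun i => ∑ n, L.Γ n n i) = τ at t ⊢
  have t' : ∀ i j, L.d j (τ i) = L.d i (τ j) := fun i j => by rw [← hτ]; exact L.d_trace_Γ i j
  have t'' : ∀ i, ∑ n, L.Γ n n i = τ i := fun i => by rw [← hτ]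
  simp only [t'']
  simp only [Fin.sum_univ_three, map_add, map_sub, Derivation.leibniz, smul_eq_mul, F0,
    hF 1 0, hF 2 0, hF 2 1, t' 0 1, t' 0 2, t' 1 2, map_neg, map_zero, L.d_comm 1 0,
    L.d_comm 2 0, L.d_comm 2 1]
  ring

theorem divUp_congr {F F' : Fin 3 → Fin 3 → A} (h : ∀ i j, F i j = F' i j) (j : Fin 3) :
    L.divUp F j = L.divUp F' j := by
  simp only [divUp, h]

theorem cov_Sq (m i j : Fin 3) : L.cov L.Sq m i j =
    ∑ k, ∑ l, L.h k l * (L.cov L.S m l i * L.S k j + L.S l i * L.cov L.S m k j) := by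
  simp only [cov, Sq, Fin.sum_univ_three, map_add, Derivation.leibniz, smul_eq_mul, L.d_h]
  ring

theorem d_nS (m : Fin 3) : L.d m L.nS = ∑ i, ∑ j, L.h i j * L.cov L.Sq m i j := by
  rw [L.cov_trace]; rfl

theorem cov_J2 (m i j : Fin 3) : L.cov L.J2 m i j =
    2 * (L.cov L.Sq m i j - L.d m L.s * L.S i j - L.s * L.cov L.S m i j)
      + L.g i j * (2 * L.s * L.d m L.s - L.d m L.nS) := by
  simp only [cov, J2, Fin.sum_univ_three, map_add, map_sub, Derivation.leibniz, smul_eq_mul,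
    L.d_g, pow_two]
  have : L.d m (2 : A) = 0 := by
    have := (L.d m).map_natCast 2
    simpa using this
  rw [this]
  ring

/-- The Cotton tensor is trace free, by the contracted Bianchi identity. -/
theorem trace_Cup (i : Fin 3) : ∑ k, L.Cup k i k = 0 := by
  have h1 : ∀ i, ∑ a, ∑ b, L.h a b * L.C a i b = 0 := fun i => by
    have e1 := L.div_S i
    have e2 := L.cov_trace L.S i
    rw [L.trace_S] at e2
    simp only [C, mul_sub, Finset.sum_sub_distrib]
    rw [e2, ← e1, sub_eq_zero]
    exact Finset.sum_congr rfl fun a _ => Finset.sum_congr rfl fun b _ => by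
      rw [L.cov_S_symm a b]
  have h2 : ∑ k, L.Cup k i k = ∑ c, L.h i c * ∑ a, ∑ b, L.h a b * L.C a c b := by
    simp only [Cup, Fin.sum_univ_three, L.h_symm 1 0, L.h_symm 2 0, L.h_symm 2 1]
    ring
  rw [h2]
  simp [h1]

/-! ### The divergence of the `K`-tensor -/

/-- `∇^i H_{ij} = -S^{kl} C_{kjl}`, from the double divergence of the Cotton tensor. -/
theorem divUp_H (j : Fin 3) : L.divUp (fun i j => ∑ b, L.h i b * L.H b j) j
    = -∑ k, ∑ l, ∑ a, ∑ b, L.S k b * L.h b l * L.h k a * L.C a j l := by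
  have h1 := L.divUp_divUp L.Cup L.Cup_antisymm j
  have h2 : L.divUp (fun i j => L.divUp (fun k j => L.Cup k i j) j) j
      = -L.divUp (fun i j => ∑ b, L.h i b * L.H b j) j := by
    rw [L.divUp_congr fun i j => L.divUp_Cup i j]
    simp only [divUp, map_neg, mul_neg, Fin.sum_univ_three]
    ring
  -- Lowering the second index of `C^{ki}{}_l`.
  have q : ∀ k l, ∑ i, L.Cup k i l * L.g i j = ∑ a, L.h k a * L.C a j l := by
    intro k l
    rw [← L.sum_h_g j fun b => ∑ a, L.h k a * L.C a b l]
    simp only [Cup, Fin.sum_univ_three, L.h_symm 1 0, L.h_symm 2 0, L.h_symm 2 1]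
    ring
  -- The two terms of the curvature decomposition that trace the Cotton tensor vanish, and the other
  -- two agree by its skew-symmetry.
  have c1 : ∀ i, ∑ k, L.S i j * L.Cup k i k = 0 := fun i => by
    rw [← Finset.mul_sum, L.trace_Cup, mul_zero]
  have c2 : ∀ k, ∑ i, L.S k j * L.Cup k i i = 0 := fun k => by
    rw [← Finset.mul_sum]
    simp only [L.Cup_antisymm k, Finset.sum_neg_distrib, L.trace_Cup, neg_zero, mul_zero]
  have c3 : ∑ i, ∑ k, ∑ l, L.Rm i k j l * L.Cup k i l
      = 2 * ∑ k, ∑ l, L.Sm k l * ∑ i, L.Cup k i l * L.g i j := by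
    have r : ∀ i k, ∑ l, L.Rm i k j l * L.Cup k i l = L.S i j * L.Cup k i k
        + (∑ l, L.Sm k l * L.Cup k i l) * L.g i j
        + (∑ l, L.Sm i l * L.Cup i k l) * L.g k j - L.S k j * L.Cup k i i := fun i k => by
      rw [L.sum_Rm_mul]
      have : ∑ l, L.Sm i l * L.Cup k i l = -∑ l, L.Sm i l * L.Cup i k l := by
        rw [← Finset.sum_neg_distrib]
        exact Finset.sum_congr rfl fun l _ => by rw [L.Cup_antisymm k i]; ring
      rw [this]; ring
    have r2 : ∑ i, ∑ k, (∑ l, L.Sm k l * L.Cup k i l) * L.g i j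
        = ∑ k, ∑ l, L.Sm k l * ∑ i, L.Cup k i l * L.g i j := by
      simp only [Fin.sum_univ_three]; ring
    have r3 : ∑ i, ∑ k, L.S k j * L.Cup k i i = 0 := by
      rw [Finset.sum_comm]; simp only [c2, Finset.sum_const_zero]
    simp only [r, Finset.sum_add_distrib, Finset.sum_sub_distrib, c1, r3, r2,
      Finset.sum_const_zero]
    have r4 : ∑ i, ∑ k, (∑ l, L.Sm i l * L.Cup i k l) * L.g k j
        = ∑ k, ∑ l, L.Sm k l * ∑ i, L.Cup k i l * L.g i j := by
      rw [← r2, Finset.sum_comm]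
    rw [r4]
    ring
  rw [h2, c3] at h1
  rw [← sub_eq_zero]
  apply eq_zero_of_two_mul
  have c4 : ∑ k, ∑ l, ∑ a, ∑ b, L.S k b * L.h b l * L.h k a * L.C a j l
      = ∑ k, ∑ l, L.Sm k l * ∑ i, L.Cup k i l * L.g i j := by
    simp only [q, Sm, Fin.sum_univ_three]; ring
  rw [c4]
  linear_combination -h1

/-- `∇^i (2 J_{ij}) = 2 S^{kl} C_{kjl}`. -/
theorem divUp_J2 (j : Fin 3) : L.divUp (fun i j => ∑ b, L.h i b * L.J2 b j) j
    = 2 * ∑ k, ∑ l, ∑ a, ∑ b, L.S k b * L.h b l * L.h k a * L.C a j l := by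
  have e1 : ∑ i, ∑ b, L.h i b * L.cov L.J2 i b j
      = 2 * ∑ i, ∑ b, L.h i b * L.cov L.Sq i b j
        - 2 * ∑ i, ∑ b, L.h i b * (L.d i L.s * L.S b j)
        - 2 * L.s * ∑ i, ∑ b, L.h i b * L.cov L.S i b j
        + ∑ i, ∑ b, L.h i b * (L.g b j * (2 * L.s * L.d i L.s - L.d i L.nS)) := by
    simp only [L.cov_J2, Finset.mul_sum, ← Finset.sum_sub_distrib, ← Finset.sum_add_distrib]
    exact Finset.sum_congr rfl fun i _ => Finset.sum_congr rfl fun b _ => by ring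
  rw [divUp_raise, e1, L.div_S, L.sum_h_g j fun i => 2 * L.s * L.d i L.s - L.d i L.nS, L.d_nS]
  -- What remains is the contracted Bianchi identity, paired with the Schouten tensor.
  have d0 := L.div_S 0
  have d1 := L.div_S 1
  have d2 := L.div_S 2
  simp only [cov_Sq, C, Fin.sum_univ_three, L.h_symm 1 0, L.h_symm 2 0, L.h_symm 2 1,
    L.S_symm 1 0, L.S_symm 2 0, L.S_symm 2 1, L.cov_S_symm _ 1 0, L.cov_S_symm _ 2 0,
    L.cov_S_symm _ 2 1, L.cov_S_symm _ 0 j, L.cov_S_symm _ 1 j, L.cov_S_symm _ 2 j]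
    at d0 d1 d2 ⊢
  linear_combination
    2 * (L.h 0 0 * L.S 0 j + L.h 0 1 * L.S 1 j + L.h 0 2 * L.S 2 j) * d0
    + 2 * (L.h 0 1 * L.S 0 j + L.h 1 1 * L.S 1 j + L.h 1 2 * L.S 2 j) * d1
    + 2 * (L.h 0 2 * L.S 0 j + L.h 1 2 * L.S 1 j + L.h 2 2 * L.S 2 j) * d2

/-- The tensor `K = 2 J + 2 H`. -/
def K (i j : Fin 3) : A := L.J2 i j + 2 * L.H i j

/-- The tensor `K` is divergence free: the divergences of `2 J` and `2 H` are opposite. -/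
theorem divUp_K (j : Fin 3) : L.divUp (fun i j => ∑ b, L.h i b * L.K b j) j = 0 := by
  have h1 := L.divUp_H j
  have h2 := L.divUp_J2 j
  have h3 : L.divUp (fun i j => ∑ b, L.h i b * L.K b j) j
      = L.divUp (fun i j => ∑ b, L.h i b * L.J2 b j) j
        + 2 * L.divUp (fun i j => ∑ b, L.h i b * L.H b j) j := by
    rw [divUp_raise, divUp_raise, divUp_raise]
    simp only [cov, K, Fin.sum_univ_three, map_add, two_mul]
    ring
  rw [h3, h1, h2]
  ring

end FormalMetric

/-! ### Smooth metrics on `ℝ³` as formal metrics -/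

/-- The algebra of smooth real functions on `ℝ³`. -/
def smoothFun : Subalgebra ℝ (E3 → ℝ) where
  carrier := {f | ContDiff ℝ ∞ f}
  mul_mem' {f g} (hf : ContDiff ℝ ∞ f) (hg : ContDiff ℝ ∞ g) := hf.mul hg
  add_mem' {f g} (hf : ContDiff ℝ ∞ f) (hg : ContDiff ℝ ∞ g) := hf.add hg
  algebraMap_mem' r := (contDiff_const : ContDiff ℝ ∞ fun _ : E3 => r)

theorem smoothFun.contDiff (f : smoothFun) : ContDiff ℝ ∞ (f : E3 → ℝ) := f.2

theorem smoothFun.differentiableAt (f : smoothFun) (y : E3) :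
    DifferentiableAt ℝ (f : E3 → ℝ) y :=
  (smoothFun.contDiff f).differentiable (by simp) y

theorem contDiff_pd {f : E3 → ℝ} (hf : ContDiff ℝ ∞ f) (i : Fin 3) : ContDiff ℝ ∞ (pd i f) :=
  (hf.fderiv_right (m := ∞) (by simp)).clm_apply contDiff_const

theorem pd_add {f g : E3 → ℝ} {y : E3} (hf : DifferentiableAt ℝ f y)
    (hg : DifferentiableAt ℝ g y) (i : Fin 3) :
    pd i (fun z => f z + g z) y = pd i f y + pd i g y := by
  simp [pd, fderiv_fun_add hf hg]

theorem pd_mul {f g : E3 → ℝ} {y : E3} (hf : DifferentiableAt ℝ f y)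
    (hg : DifferentiableAt ℝ g y) (i : Fin 3) :
    pd i (fun z => f z * g z) y = f y * pd i g y + g y * pd i f y := by
  simp [pd, fderiv_fun_mul hf hg]

theorem pd_comm {f : E3 → ℝ} {y : E3} (hf : ContDiffAt ℝ 2 f y) (i j : Fin 3) :
    pd i (pd j f) y = pd j (pd i f) y := by
  have h1 : DifferentiableAt ℝ (fderiv ℝ f) y :=
    (hf.fderiv_right (m := 1) (by norm_num)).differentiableAt (by norm_num)
  have h2 := (hf.isSymmSndFDerivAt (by simp)).eq (EuclideanSpace.single i 1)
    (EuclideanSpace.single j 1)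
  -- The mixed partial derivatives are values of the second derivative, a symmetric bilinear form.
  have h3 : ∀ i j, pd i (pd j f) y = fderiv ℝ (fderiv ℝ f) y (EuclideanSpace.single i 1)
      (EuclideanSpace.single j 1) := by
    intro i j
    change fderiv ℝ (fun z => fderiv ℝ f z (EuclideanSpace.single j 1)) y _ = _
    rw [fderiv_clm_apply h1 (differentiableAt_const _)]
    simp
  rw [h3, h3, h2]

/-- The partial derivative `∂ᵢ` as a derivation of the algebra of smooth functions. -/
def pdDer (i : Fin 3) : Derivation ℝ smoothFun smoothFun :=
  Derivation.mk'
    { toFun := fun f => ⟨pd i f, contDiff_pd f.2 i⟩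
      map_add' := fun f g => Subtype.ext <| funext fun y =>
        pd_add (smoothFun.differentiableAt f y) (smoothFun.differentiableAt g y) i
      map_smul' := fun r f => Subtype.ext <| funext fun y => by
        change pd i (fun z => r * (f : E3 → ℝ) z) y = r * pd i f y
        rw [pd_mul (differentiableAt_const _) (smoothFun.differentiableAt f y)]
        simp [pd] }
    fun f g => Subtype.ext <| funext fun y =>
      pd_mul (smoothFun.differentiableAt f y) (smoothFun.differentiableAt g y) i

section

variable {G : E3 → Matrix (Fin 3) (Fin 3) ℝ}

theorem contDiffOn_det {U : Set E3} (hG : ∀ i j, ContDiffOn ℝ ∞ (fun y => G y i j) U) :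
    ContDiffOn ℝ ∞ (fun y => (G y).det) U := by
  simp only [Matrix.det_fin_three]
  fun_prop

theorem contDiffOn_inv {U : Set E3} (hG : ∀ i j, ContDiffOn ℝ ∞ (fun y => G y i j) U)
    (hd : ∀ y ∈ U, (G y).det ≠ 0) (i j : Fin 3) :
    ContDiffOn ℝ ∞ (fun y => (G y)⁻¹ i j) U := by
  have h1 : ∀ y, (G y)⁻¹ i j = ((G y).det)⁻¹ * (G y).adjugate i j := fun y => by
    rw [Matrix.inv_def, Ring.inverse_eq_inv', Matrix.smul_apply, smul_eq_mul]
  simp only [h1, Matrix.adjugate_fin_three]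
  refine ((contDiffOn_det hG).inv hd).mul ?_
  fin_cases i <;> fin_cases j <;> simp <;> fun_prop

end

theorem inv_symm {g : Matrix (Fin 3) (Fin 3) ℝ} (hs : ∀ i j, g i j = g j i) (i j : Fin 3) :
    g⁻¹ i j = g⁻¹ j i := by
  have : g.transpose = g := by ext i j; exact hs j i
  rw [← Matrix.transpose_apply g⁻¹, Matrix.transpose_nonsing_inv, this]

theorem sum_inv_mul {g : Matrix (Fin 3) (Fin 3) ℝ} (hd : g.det ≠ 0) (i j : Fin 3) :
    ∑ k, g⁻¹ i k * g k j = if i = j then 1 else 0 := by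
  rw [← Matrix.mul_apply, Matrix.nonsing_inv_mul _ (isUnit_iff_ne_zero.2 hd), Matrix.one_apply]

theorem christoffel_symm {G : E3 → Matrix (Fin 3) (Fin 3) ℝ} (hs : ∀ y i j, G y i j = G y j i)
    (k i j : Fin 3) (y : E3) : christoffel G k i j y = christoffel G k j i y := by
  simp only [christoffel]
  congr 1
  refine Finset.sum_congr rfl fun l _ => ?_
  have : (fun z => G z i j) = fun z => G z j i := funext fun z => hs z i j
  rw [this]; ring

/-- The connection with the given Christoffel symbols is metric. -/
theorem pd_metric {G : E3 → Matrix (Fin 3) (Fin 3) ℝ} (hs : ∀ y i j, G y i j = G y j i) {y : E3}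
    (hd : (G y).det ≠ 0) (k i j : Fin 3) :
    pd k (fun z => G z i j) y = ∑ n, christoffel G n k i y * G y n j
      + ∑ n, christoffel G n k j y * G y i n := by
  have key : ∀ (v : Fin 3 → ℝ) j, ∑ n, (1 / 2 * ∑ l, (G y)⁻¹ n l * v l) * G y n j
      = 1 / 2 * v j := by
    intro v j
    have h1 : ∀ l, ∑ n, (G y)⁻¹ l n * G y n j = if l = j then 1 else 0 :=
      fun l => sum_inv_mul hd l j
    calc _ = 1 / 2 * ∑ l, v l * ∑ n, (G y)⁻¹ n l * G y n j := by
          simp only [Fin.sum_univ_three]; ring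
      _ = _ := by
        simp only [fun n l => inv_symm (hs y) n l]
        simp [h1]
  have e : ∀ n, G y i n = G y n i := fun n => hs y i n
  have e2 : ∀ i j, (fun z => G z i j) = fun z => G z j i := fun i j => funext fun z => hs z i j
  simp only [e, christoffel]
  rw [key, key, e2 j i]
  ring

/-- The formal metric given by a globally defined smooth Riemannian metric on `ℝ³`. -/
def toFormal (G : E3 → Matrix (Fin 3) (Fin 3) ℝ) (hG : ∀ i j, ContDiff ℝ ∞ fun y => G y i j)
    (hs : ∀ y i j, G y i j = G y j i) (hd : ∀ y, (G y).det ≠ 0) : FormalMetric smoothFun :=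
  have hinv : ∀ i j, ContDiff ℝ ∞ fun y => (G y)⁻¹ i j := fun i j =>
    contDiffOn_univ.1 (contDiffOn_inv (fun i j => (hG i j).contDiffOn) (fun y _ => hd y) i j)
  have hp : ∀ k i j, ContDiff ℝ ∞ (pd k fun z => G z i j) := fun k i j => contDiff_pd (hG i j) k
  have hΓ : ∀ k i j, ContDiff ℝ ∞ (christoffel G k i j) := fun k i j => by
    unfold christoffel
    exact contDiff_const.mul (ContDiff.sum fun l _ =>
      (hinv k l).mul (((hp i j l).add (hp j i l)).sub (hp l i j)))
  { d := pdDer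
    g := fun i j => ⟨fun y => G y i j, hG i j⟩
    h := fun i j => ⟨fun y => (G y)⁻¹ i j, hinv i j⟩
    Γ := fun k i j => ⟨christoffel G k i j, hΓ k i j⟩
    d_comm := fun i j a => Subtype.ext <| funext fun y =>
      pd_comm (contDiff_infty.1 (smoothFun.contDiff a) 2).contDiffAt i j
    g_symm := fun i j => Subtype.ext <| funext fun y => hs y i j
    h_symm := fun i j => Subtype.ext <| funext fun y => inv_symm (hs y) i j
    h_mul_g := fun i j => Subtype.ext <| funext fun y => by
      have := sum_inv_mul (hd y) i j
      rw [AddSubmonoidClass.coe_finsetSum, Finset.sum_apply]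
      split_ifs at this ⊢ <;> exact this
    Γ_symm := fun k i j => Subtype.ext <| funext fun y => christoffel_symm hs k i j y
    d_g := fun k i j => Subtype.ext <| funext fun y => by
      have := pd_metric hs (hd y) k i j
      rw [Subalgebra.coe_add, Pi.add_apply, AddSubmonoidClass.coe_finsetSum,
        AddSubmonoidClass.coe_finsetSum, Finset.sum_apply, Finset.sum_apply]
      exact this }

section Global

variable (G : E3 → Matrix (Fin 3) (Fin 3) ℝ) (hG : ∀ i j, ContDiff ℝ ∞ fun y => G y i j)
    (hs : ∀ y i j, G y i j = G y j i) (hd : ∀ y, (G y).det ≠ 0)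

theorem coe_sum_apply (f : Fin 3 → smoothFun) (y : E3) :
    ((∑ i, f i : smoothFun) : E3 → ℝ) y = ∑ i, (f i : E3 → ℝ) y := by
  rw [AddSubmonoidClass.coe_finsetSum, Finset.sum_apply]

theorem coe_add_apply (f g : smoothFun) (y : E3) :
    ((f + g : smoothFun) : E3 → ℝ) y = f.1 y + g.1 y := rfl
theorem coe_sub_apply (f g : smoothFun) (y : E3) :
    ((f - g : smoothFun) : E3 → ℝ) y = f.1 y - g.1 y := rfl
theorem coe_mul_apply (f g : smoothFun) (y : E3) :
    ((f * g : smoothFun) : E3 → ℝ) y = f.1 y * g.1 y := rfl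

theorem coe_d (i : Fin 3) (f : smoothFun) (y : E3) :
    (((toFormal G hG hs hd).d i f : smoothFun) : E3 → ℝ) y = pd i f.1 y := rfl
theorem coe_g (i j : Fin 3) (y : E3) :
    (((toFormal G hG hs hd).g i j : smoothFun) : E3 → ℝ) y = G y i j := rfl
theorem coe_h (i j : Fin 3) (y : E3) :
    (((toFormal G hG hs hd).h i j : smoothFun) : E3 → ℝ) y = (G y)⁻¹ i j := rfl
theorem coe_Γ (k i j : Fin 3) :
    (((toFormal G hG hs hd).Γ k i j : smoothFun) : E3 → ℝ) = christoffel G k i j := rfl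

theorem coe_Rm (i j k l : Fin 3) :
    (((toFormal G hG hs hd).Rm i j k l : smoothFun) : E3 → ℝ) = riemann G i j k l := by
  funext y
  simp only [FormalMetric.Rm, riemann, coe_sum_apply, coe_add_apply, coe_sub_apply, coe_mul_apply,
    coe_d, coe_Γ]

theorem coe_Ric (i j : Fin 3) :
    (((toFormal G hG hs hd).Ric i j : smoothFun) : E3 → ℝ) = fun y => ricci G y i j := by
  funext y
  simp only [FormalMetric.Ric, ricci, coe_sum_apply, coe_Rm, Matrix.of_apply]

theorem coe_s : (((toFormal G hG hs hd).s : smoothFun) : E3 → ℝ) = schoutenTr G := by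
  funext y
  simp only [FormalMetric.s, schoutenTr, scalar]
  rw [Subalgebra.coe_smul, Pi.smul_apply, smul_eq_mul, div_eq_inv_mul, coe_sum_apply]
  simp only [coe_sum_apply, coe_mul_apply, coe_Ric, coe_h]
  ring

theorem coe_S (i j : Fin 3) :
    (((toFormal G hG hs hd).S i j : smoothFun) : E3 → ℝ) = fun y => schouten G y i j := by
  funext y
  simp only [FormalMetric.S, schouten, coe_sub_apply, coe_mul_apply, coe_Ric, coe_s, coe_g,
    Matrix.of_apply,
    schoutenTr]
  ring

theorem coe_cov {T : Fin 3 → Fin 3 → smoothFun} {T' : E3 → Matrix (Fin 3) (Fin 3) ℝ}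
    (hT : ∀ i j, (T i j : E3 → ℝ) = fun y => T' y i j) (k i j : Fin 3) :
    (((toFormal G hG hs hd).cov T k i j : smoothFun) : E3 → ℝ) = covD G T' k i j := by
  funext y
  simp only [FormalMetric.cov, covD, coe_sum_apply, coe_sub_apply, coe_mul_apply, coe_d, coe_Γ, hT]

theorem coe_lap {T : Fin 3 → Fin 3 → smoothFun} {T' : E3 → Matrix (Fin 3) (Fin 3) ℝ}
    (hT : ∀ i j, (T i j : E3 → ℝ) = fun y => T' y i j) (i j : Fin 3) (y : E3) :
    (((toFormal G hG hs hd).lap T i j : smoothFun) : E3 → ℝ) y = laplacian G T' y i j := by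
  simp only [FormalMetric.lap, laplacian, FormalMetric.cov3, covD2, coe_sum_apply, coe_sub_apply,
    coe_mul_apply,
    coe_d, coe_h, coe_Γ, coe_cov G hG hs hd hT, Matrix.of_apply]

theorem coe_K (i j : Fin 3) :
    (((toFormal G hG hs hd).K i j : smoothFun) : E3 → ℝ) = fun y => tensorK G y i j := by
  funext y
  have two : ((2 : smoothFun) : E3 → ℝ) y = 2 := rfl
  have three : ((3 : smoothFun) : E3 → ℝ) y = 3 := rfl
  simp only [FormalMetric.K, FormalMetric.J2, FormalMetric.H, FormalMetric.Sq, FormalMetric.nS,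
    FormalMetric.hess, pow_two,
    tensorK, tensorJ, tensorH, schoutenSq, schoutenNormSq, hessian, coe_add_apply, coe_sub_apply,
      coe_mul_apply,
    coe_sum_apply, coe_lap G hG hs hd (coe_S G hG hs hd), coe_S, coe_d, coe_s, coe_g, coe_h, coe_Γ,
    Matrix.of_apply, two, three]
  have : ((toFormal G hG hs hd).d j (toFormal G hG hs hd).s : E3 → ℝ) = pd j (schoutenTr G) := by
    funext z; rw [coe_d, coe_s]
  rw [this]
  ring

/-- The divergence of `K` vanishes for a metric defined on all of `ℝ³`. -/
theorem tensorK_div_global (G : E3 → Matrix (Fin 3) (Fin 3) ℝ)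
    (hG : ∀ i j, ContDiff ℝ ∞ fun y => G y i j)
    (hs : ∀ y i j, G y i j = G y j i) (hd : ∀ y, (G y).det ≠ 0) (j : Fin 3) (y : E3) :
    ∑ i, (pd i (fun z => ∑ b, (G z)⁻¹ i b * tensorK G z b j) y
      + (∑ n, christoffel G n n i y) * ∑ b, (G y)⁻¹ i b * tensorK G y b j
      - ∑ l, christoffel G l i j y * ∑ b, (G y)⁻¹ i b * tensorK G y b l) = 0 := by
  have h := congrArg (fun f : smoothFun => f.1 y) ((toFormal G hG hs hd).divUp_K j)
  have e : ∀ i j, ((∑ b, (toFormal G hG hs hd).h i b * (toFormal G hG hs hd).K b j : smoothFun) :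
      E3 → ℝ) = fun z => ∑ b, (G z)⁻¹ i b * tensorK G z b j := by
    intro i j; funext z
    simp only [coe_sum_apply, coe_mul_apply, coe_h, coe_K]
  simp only [FormalMetric.divUp, coe_sum_apply, coe_add_apply, coe_sub_apply, coe_mul_apply,
    coe_d, coe_Γ, e, coe_h,
    coe_K] at h
  exact h

end Global

open Set

/-! ### Locality of the curvature tensors -/

section Locality

variable {V : Set E3}

theorem EqOn.pd {f g : E3 → ℝ} (hV : IsOpen V) (h : EqOn f g V) (i : Fin 3) :
    EqOn (pd i f) (pd i g) V := fun y hy => by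
  have : f =ᶠ[nhds y] g := Filter.eventually_of_mem (hV.mem_nhds hy) h
  simp only [KFlow.pd, this.fderiv_eq]

variable {G G' : E3 → Matrix (Fin 3) (Fin 3) ℝ}

theorem EqOn.christoffel (hV : IsOpen V) (h : EqOn G G' V) (k i j : Fin 3) :
    EqOn (christoffel G k i j) (christoffel G' k i j) V := fun y hy => by
  have h1 : ∀ i j k, KFlow.pd k (fun z => G z i j) y = KFlow.pd k (fun z => G' z i j) y :=
    fun i j k => EqOn.pd hV (fun z hz => by simp only [h hz]) k hy
  simp only [KFlow.christoffel, h hy, h1]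

theorem EqOn.riemann (hV : IsOpen V) (h : EqOn G G' V) (i j k l : Fin 3) :
    EqOn (riemann G i j k l) (riemann G' i j k l) V := fun y hy => by
  have h1 := fun k i j => EqOn.christoffel hV h k i j hy
  have h2 := fun k i j m => EqOn.pd hV (EqOn.christoffel hV h k i j) m hy
  simp only [KFlow.riemann, h1, h2]

theorem EqOn.ricci (hV : IsOpen V) (h : EqOn G G' V) : EqOn (ricci G) (ricci G') V :=
  fun y hy => by
  have h1 := fun i j k l => EqOn.riemann hV h i j k l hy
  simp only [KFlow.ricci, h1]

theorem EqOn.schoutenTr (hV : IsOpen V) (h : EqOn G G' V) :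
    EqOn (schoutenTr G) (schoutenTr G') V := fun y hy => by
  simp only [KFlow.schoutenTr, scalar, h hy, EqOn.ricci hV h hy]

theorem EqOn.schouten (hV : IsOpen V) (h : EqOn G G' V) :
    EqOn (schouten G) (schouten G') V := fun y hy => by
  simp only [KFlow.schouten, scalar, h hy, EqOn.ricci hV h hy]

theorem EqOn.covD {T T' : E3 → Matrix (Fin 3) (Fin 3) ℝ} (hV : IsOpen V) (h : EqOn G G' V)
    (hT : EqOn T T' V) (k i j : Fin 3) : EqOn (covD G T k i j) (covD G' T' k i j) V :=
  fun y hy => by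
  have h1 := fun k i j => EqOn.christoffel hV h k i j hy
  have h2 : ∀ i j k, KFlow.pd k (fun z => T z i j) y = KFlow.pd k (fun z => T' z i j) y :=
    fun i j k => EqOn.pd hV (fun z hz => by simp only [hT hz]) k hy
  simp only [KFlow.covD, h1, h2, hT hy]

theorem EqOn.laplacian {T T' : E3 → Matrix (Fin 3) (Fin 3) ℝ} (hV : IsOpen V) (h : EqOn G G' V)
    (hT : EqOn T T' V) : EqOn (laplacian G T) (laplacian G' T') V :=
  fun y hy => by
  have h1 := fun k i j => EqOn.christoffel hV h k i j hy
  have h2 := fun k i j => EqOn.covD hV h hT k i j hy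
  have h3 := fun k i j m => EqOn.pd hV (EqOn.covD hV h hT k i j) m hy
  simp only [KFlow.laplacian, covD2, h hy, h1, h2, h3]

theorem EqOn.hessian {f f' : E3 → ℝ} (hV : IsOpen V) (h : EqOn G G' V)
    (hf : EqOn f f' V) : EqOn (hessian G f) (hessian G' f') V :=
  fun y hy => by
  have h1 := fun k i j => EqOn.christoffel hV h k i j hy
  have h2 := fun i => EqOn.pd hV hf i hy
  have h3 := fun i j => EqOn.pd hV (EqOn.pd hV hf i) j hy
  simp only [KFlow.hessian, h1, h2, h3]

theorem EqOn.tensorK (hV : IsOpen V) (h : EqOn G G' V) : EqOn (tensorK G) (tensorK G') V :=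
  fun y hy => by
  have h1 := EqOn.laplacian hV h (EqOn.schouten hV h) hy
  have h2 := EqOn.hessian hV h (EqOn.schoutenTr hV h) hy
  simp only [KFlow.tensorK, tensorJ, tensorH, schoutenNormSq, schoutenSq, h hy, h1, h2,
    EqOn.schouten hV h hy, EqOn.schoutenTr hV h hy]

theorem tensorK_eq_zero_of_riemann (hV : IsOpen V)
    (h : ∀ i j k l, EqOn (riemann G i j k l) 0 V) : EqOn (tensorK G) 0 V := by
  have hr : EqOn (ricci G) 0 V := fun y hy => by
    ext i j; simp [KFlow.ricci, fun i j k l => h i j k l hy]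
  have hs : EqOn (scalar G) 0 V := fun y hy => by simp [scalar, hr hy]
  have ht : EqOn (schoutenTr G) (fun _ => 0) V := fun y hy => by simp [KFlow.schoutenTr, hs hy]
  have hS : EqOn (schouten G) (fun _ => 0) V := fun y hy => by
    ext i j; simp [KFlow.schouten, hs hy, hr hy]
  have hpd : ∀ i, KFlow.pd i (fun _ => 0) = fun _ => 0 := fun i => by
    funext y; simp [KFlow.pd]
  intro y hy
  have h1 := EqOn.laplacian hV (eqOn_refl G V) hS hy
  have h2 := EqOn.hessian hV (eqOn_refl G V) ht hy
  have hc : ∀ k i j, covD G (fun _ => 0) k i j = fun _ => 0 := fun k i j => by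
    funext z; simp [KFlow.covD, hpd]
  have h3 : laplacian G (fun _ => 0) y = 0 := by
    ext i j; simp [KFlow.laplacian, covD2, hc, hpd]
  have h4 : hessian G (fun _ => 0) y = 0 := by
    ext i j; simp [KFlow.hessian, hpd]
  ext i j
  simp [KFlow.tensorK, tensorJ, tensorH, schoutenNormSq, schoutenSq, h1, h2, h3, h4, hS hy, ht hy]

end Locality

section Local

variable {U : Set E3} {G : E3 → Matrix (Fin 3) (Fin 3) ℝ}

/-- A Riemannian metric on an open set agrees near a given point with one defined on all of `ℝ³`:
a cutoff function interpolates between it and the Euclidean metric. -/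
theorem exists_global_metric (hU : IsOpen U) (hG : ∀ i j, ContDiffOn ℝ ∞ (fun y => G y i j) U)
    (hp : ∀ y ∈ U, (G y).PosDef) {y : E3} (hy : y ∈ U) :
    ∃ G' : E3 → Matrix (Fin 3) (Fin 3) ℝ, (∀ i j, ContDiff ℝ ∞ fun y => G' y i j) ∧
      (∀ y, (G' y).PosDef) ∧ ∃ V, IsOpen V ∧ y ∈ V ∧ EqOn G G' V := by
  obtain ⟨r, hr, hrU⟩ := Metric.nhds_basis_closedBall.mem_iff.1 (hU.mem_nhds hy)
  let χ : ContDiffBump y := ⟨r / 2, r, by positivity, by linarith⟩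
  refine ⟨fun z => χ z • G z + (1 - χ z) • 1, fun i j => ?_, fun z => ?_,
    Metric.ball y (r / 2), Metric.isOpen_ball, Metric.mem_ball_self (by positivity), fun z hz => ?_⟩
  · simp only [Matrix.add_apply, Matrix.smul_apply, smul_eq_mul]
    refine ContDiff.add ?_ ((contDiff_const.sub χ.contDiff).mul contDiff_const)
    rw [contDiff_iff_contDiffAt]
    intro z
    by_cases hz : z ∈ U
    · exact χ.contDiff.contDiffAt.mul ((hG i j).contDiffAt (hU.mem_nhds hz))
    · have : (fun z => χ z * G z i j) =ᶠ[nhds z] fun _ => 0 := by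
        have h1 : z ∉ tsupport χ := fun h => hz (hrU (by rwa [χ.tsupport_eq] at h))
        filter_upwards [(isClosed_tsupport χ).isOpen_compl.mem_nhds h1] with x hx
        rw [image_eq_zero_of_notMem_tsupport hx, zero_mul]
      exact contDiffAt_const.congr_of_eventuallyEq this
  · by_cases hz : z ∈ U
    · rcases (χ.nonneg' z).eq_or_lt with h | h
      · simpa [← h] using Matrix.PosDef.one
      · exact ((hp z hz).smul h).add_posSemidef
          (Matrix.PosSemidef.one.smul (sub_nonneg.2 χ.le_one))
    · have h1 : χ z = 0 := image_eq_zero_of_notMem_tsupport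
        fun h => hz (hrU (by rwa [χ.tsupport_eq] at h))
      simpa [h1] using Matrix.PosDef.one
  · have : χ z = 1 := χ.one_of_mem_closedBall (Metric.ball_subset_closedBall hz)
    simp [this]

theorem posDef_apply_comm {g : Matrix (Fin 3) (Fin 3) ℝ} (h : g.PosDef) (i j : Fin 3) :
    g i j = g j i := by
  simpa using (h.isHermitian.apply i j).symm

/-- The divergence of `K` vanishes for a metric on an open set: this is a local statement, so
`tensorK_div_global` applies to an extension of the metric. -/
theorem tensorK_div (hU : IsOpen U) (hG : ∀ i j, ContDiffOn ℝ ∞ (fun y => G y i j) U)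
    (hp : ∀ y ∈ U, (G y).PosDef) {y : E3} (hy : y ∈ U) (j : Fin 3) :
    ∑ i, (pd i (fun z => ∑ b, (G z)⁻¹ i b * tensorK G z b j) y
      + (∑ n, christoffel G n n i y) * ∑ b, (G y)⁻¹ i b * tensorK G y b j
      - ∑ l, christoffel G l i j y * ∑ b, (G y)⁻¹ i b * tensorK G y b l) = 0 := by
  obtain ⟨G', h1, h2, V, hV, hyV, hGV⟩ := exists_global_metric hU hG hp hy
  have h := tensorK_div_global G' h1 (fun y => posDef_apply_comm (h2 y)) (fun y => (h2
    y).det_pos.ne') j y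
  have e1 : ∀ i, pd i (fun z => ∑ b, (G z)⁻¹ i b * tensorK G z b j) y
      = pd i (fun z => ∑ b, (G' z)⁻¹ i b * tensorK G' z b j) y := fun i =>
    EqOn.pd hV (fun z hz => by simp only [hGV hz, EqOn.tensorK hV hGV hz]) i hyV
  have e2 := fun k i j => EqOn.christoffel hV hGV k i j hyV
  simp only [e1, e2, hGV hyV, EqOn.tensorK hV hGV hyV, h]

end Local

/-! ### The divergence identity in a coordinate domain -/

theorem contDiffOn_pd {U : Set E3} (hU : IsOpen U) {f : E3 → ℝ} (hf : ContDiffOn ℝ ∞ f U)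
    (i : Fin 3) : ContDiffOn ℝ ∞ (pd i f) U :=
  (hf.fderiv_of_isOpen hU (m := ∞) (by simp)).clm_apply contDiffOn_const

theorem differentiableAt_of_contDiffOn {U : Set E3} (hU : IsOpen U) {f : E3 → ℝ}
    (hf : ContDiffOn ℝ ∞ f U) {y : E3} (hy : y ∈ U) : DifferentiableAt ℝ f y :=
  (hf.contDiffAt (hU.mem_nhds hy)).differentiableAt (by simp)

theorem pd_sum {f : Fin 3 → E3 → ℝ} {y : E3} (hf : ∀ j, DifferentiableAt ℝ (f j) y) (i : Fin 3) :
    pd i (fun z => ∑ j, f j z) y = ∑ j, pd i (f j) y := by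
  simp only [Fin.sum_univ_three]
  rw [pd_add ((hf 0).fun_add (hf 1)) (hf 2), pd_add (hf 0) (hf 1)]

section Local

variable {U : Set E3} {G : E3 → Matrix (Fin 3) (Fin 3) ℝ} {V : E3 → Fin 3 → ℝ}

theorem contDiffOn_lieMetric (hU : IsOpen U) (hG : ∀ i j, ContDiffOn ℝ ∞ (fun y => G y i j) U)
    (hV : ∀ i, ContDiffOn ℝ ∞ (fun y => V y i) U) (i j : Fin 3) :
    ContDiffOn ℝ ∞ (fun y => lieMetric G V y i j) U := by
  simp only [lieMetric, Matrix.of_apply]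
  exact ContDiffOn.sum fun k _ => (((hV k).mul (contDiffOn_pd hU (hG i j) k)).add
    ((hG k j).mul (contDiffOn_pd hU (hV k) i))).add ((hG i k).mul (contDiffOn_pd hU (hV k) j))

/-- Jacobi's formula: `∂ᵢ √(det g) = √(det g) Γⁿₙᵢ`. -/
theorem pd_sqrt_det (hU : IsOpen U) (hG : ∀ i j, ContDiffOn ℝ ∞ (fun y => G y i j) U)
    (hs : ∀ y i j, G y i j = G y j i) {y : E3} (hy : y ∈ U) (hd : 0 < (G y).det) (i : Fin 3) :
    pd i (fun z => Real.sqrt (G z).det) y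
      = Real.sqrt (G y).det * ∑ n, christoffel G n n i y := by
  have hdiff : ∀ i j, DifferentiableAt ℝ (fun y => G y i j) y :=
    fun i j => differentiableAt_of_contDiffOn hU (hG i j) hy
  have h1 : pd i (fun z => (G z).det) y = 2 * (G y).det * ∑ n, christoffel G n n i y := by
    have e : ∀ a b, pd i (fun z => G z a b) y = _ := fun a b => pd_metric hs hd.ne' i a b
    -- The constant sign comes first in each term, to match `t` and `tn`.
    have hdet : (fun z => (G z).det) = fun z =>
        G z 0 0 * (G z 1 1 * G z 2 2) + (-1) * (G z 0 0 * (G z 1 2 * G z 2 1))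
        + (-1) * (G z 0 1 * (G z 1 0 * G z 2 2)) + G z 0 1 * (G z 1 2 * G z 2 0)
        + G z 0 2 * (G z 1 0 * G z 2 1) + (-1) * (G z 0 2 * (G z 1 1 * G z 2 0)) := by
      funext z; rw [Matrix.det_fin_three]; ring
    have t : ∀ a b c d e f, pd i (fun z => G z a b * (G z c d * G z e f)) y
        = G y a b * (G y c d * pd i (fun z => G z e f) y + G y e f * pd i (fun z => G z c d) y)
          + G y c d * G y e f * pd i (fun z => G z a b) y := fun a b c d e f => by
      rw [pd_mul (hdiff a b) ((hdiff c d).fun_mul (hdiff e f)), pd_mul (hdiff c d) (hdiff e f)]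
    have td : ∀ a b c d e f, DifferentiableAt ℝ (fun z => G z a b * (G z c d * G z e f)) y :=
      fun a b c d e f => (hdiff _ _).mul ((hdiff _ _).mul (hdiff _ _))
    have tn : ∀ a b c d e f, pd i (fun z => (-1) * (G z a b * (G z c d * G z e f))) y
        = -pd i (fun z => G z a b * (G z c d * G z e f)) y := fun a b c d e f => by
      rw [pd_mul (differentiableAt_const _) (td _ _ _ _ _ _)]; simp [pd]
    have tdn : ∀ a b c d e f,
        DifferentiableAt ℝ (fun z => (-1) * (G z a b * (G z c d * G z e f))) y :=
      fun a b c d e f => (differentiableAt_const _).mul (td _ _ _ _ _ _)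
    rw [hdet, pd_add (by fun_prop) (by fun_prop), pd_add (by fun_prop) (by fun_prop),
      pd_add (by fun_prop) (by fun_prop), pd_add (by fun_prop) (by fun_prop),
      pd_add (by fun_prop) (by fun_prop)]
    simp only [t, tn, e, Matrix.det_fin_three, Fin.sum_univ_three, hs y 1 0, hs y 2 0, hs y 2 1,
      fun n => christoffel_symm hs n i 0 y, fun n => christoffel_symm hs n i 1 y,
      fun n => christoffel_symm hs n i 2 y]
    ring
  have h2 : HasFDerivAt (fun z => (G z).det) (fderiv ℝ (fun z => (G z).det) y) y :=
    (differentiableAt_of_contDiffOn hU (contDiffOn_det hG) hy).hasFDerivAt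
  have h3 := (h2.sqrt hd.ne').fderiv
  simp only [pd] at h1 ⊢
  rw [h3]
  simp only [FunLike.coe_smul, Pi.smul_apply, smul_eq_mul, h1]
  have h4 := Real.mul_self_sqrt hd.le
  have h5 : Real.sqrt (G y).det ≠ 0 := (Real.sqrt_pos.2 hd).ne'
  field_simp
  rw [pow_two, h4]

/-- The components of the vector field `Tⁱⱼ Vʲ`, where the first index of `T` is raised by `G`. -/
def flux (G T : E3 → Matrix (Fin 3) (Fin 3) ℝ) (V : E3 → Fin 3 → ℝ) (i : Fin 3) (y : E3) : ℝ :=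
  ∑ j, (∑ b, (G y)⁻¹ i b * T y b j) * V y j

theorem contDiffOn_flux {T : E3 → Matrix (Fin 3) (Fin 3) ℝ}
    (hG : ∀ i j, ContDiffOn ℝ ∞ (fun y => G y i j) U)
    (hT : ∀ i j, ContDiffOn ℝ ∞ (fun y => T y i j) U)
    (hd : ∀ y ∈ U, (G y).det ≠ 0) (hV : ∀ i, ContDiffOn ℝ ∞ (fun y => V y i) U) (i : Fin 3) :
    ContDiffOn ℝ ∞ (flux G T V i) U :=
  ContDiffOn.sum fun j _ => (ContDiffOn.sum fun b _ =>
    (contDiffOn_inv hG hd i b).mul (hT b j)).mul (hV j)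

/-- If `ℒ_V g = K`, the divergence of the vector field `Kⁱⱼ Vʲ` is `½ |ℒ_V g|²`: as `K` is
divergence free it is `K^{ij} ∇ᵢ Vⱼ`, and `K` is symmetric. Both sides carry the factor
`√(det g)`. -/
theorem div_flux (hU : IsOpen U) (hG : ∀ i j, ContDiffOn ℝ ∞ (fun y => G y i j) U)
    (hs : ∀ y i j, G y i j = G y j i) (hp : ∀ y ∈ U, (G y).PosDef)
    (hV : ∀ i, ContDiffOn ℝ ∞ (fun y => V y i) U)
    (hK : EqOn (lieMetric G V) (tensorK G) U) {y : E3} (hy : y ∈ U) :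
    ∑ i, pd i (fun z => Real.sqrt (G z).det * flux G (lieMetric G V) V i z) y
      = Real.sqrt (G y).det * (1 / 2 * normSq (G y) (lieMetric G V y)) := by
  have hd : 0 < (G y).det := (hp y hy).det_pos
  have hT := contDiffOn_lieMetric hU hG hV
  have hinv := contDiffOn_inv hG fun y hy => (hp y hy).det_pos.ne'
  have hP : ∀ i j, DifferentiableAt ℝ (fun z => ∑ b, (G z)⁻¹ i b * lieMetric G V z b j) y :=
    fun i j => differentiableAt_of_contDiffOn hU
      (ContDiffOn.sum fun b _ => (hinv i b).mul (hT b j)) hy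
  have hV' : ∀ i, DifferentiableAt ℝ (fun z => V z i) y :=
    fun i => differentiableAt_of_contDiffOn hU (hV i) hy
  have hw : DifferentiableAt ℝ (fun z => Real.sqrt (G z).det) y :=
    (differentiableAt_of_contDiffOn hU (contDiffOn_det hG) hy).sqrt hd.ne'
  have e1 : ∀ i, pd i (fun z => Real.sqrt (G z).det * flux G (lieMetric G V) V i z) y
      = Real.sqrt (G y).det * (∑ j, ((∑ b, (G y)⁻¹ i b * lieMetric G V y b j)
            * pd i (fun z => V z j) y
          + V y j * pd i (fun z => ∑ b, (G z)⁻¹ i b * lieMetric G V z b j) y)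
        + flux G (lieMetric G V) V i y * ∑ n, christoffel G n n i y) := by
    intro i
    rw [pd_mul hw (differentiableAt_of_contDiffOn hU
      (contDiffOn_flux hG hT (fun y hy => (hp y hy).det_pos.ne') hV i) hy),
      pd_sqrt_det hU hG hs hy hd]
    have : pd i (flux G (lieMetric G V) V i) y = _ :=
      (pd_sum (fun j => (hP i j).fun_mul (hV' j)) i).trans
        (Finset.sum_congr rfl fun j _ => pd_mul (hP i j) (hV' j) i)
    rw [this]
    ring
  have hdiv : ∀ j, ∑ i, (pd i (fun z => ∑ b, (G z)⁻¹ i b * lieMetric G V z b j) y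
      + (∑ n, christoffel G n n i y) * ∑ b, (G y)⁻¹ i b * lieMetric G V y b j
      - ∑ l, christoffel G l i j y * ∑ b, (G y)⁻¹ i b * lieMetric G V y b l) = 0 := by
    intro j
    rw [← tensorK_div hU hG hp hy j]
    have : ∀ i, pd i (fun z => ∑ b, (G z)⁻¹ i b * lieMetric G V z b j) y
        = pd i (fun z => ∑ b, (G z)⁻¹ i b * tensorK G z b j) y := fun i =>
      EqOn.pd hU (fun z hz => by simp only [hK hz]) i hy
    simp only [this, hK hy]
  simp only [e1, ← Finset.mul_sum]
  congr 1
  have hTs : ∀ i j, lieMetric G V y i j = lieMetric G V y j i := fun i j => by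
    have : (fun z => G z i j) = fun z => G z j i := funext fun z => hs z i j
    simp only [lieMetric, Matrix.of_apply, this, hs y i, hs y j]
    exact Finset.sum_congr rfl fun _ _ => by ring
  -- `Q` is `ℒ_V g` with both indices raised; it is kept opaque so that the last step, a polynomial
  -- identity, is linear in it.
  obtain ⟨Q, hQ⟩ : ∃ Q : Fin 3 → Fin 3 → ℝ, ∀ i j, Q i j =
    ∑ k, ∑ l, (G y)⁻¹ i k * (G y)⁻¹ j l * lieMetric G V y k l := ⟨_, fun _ _ => rfl⟩
  have hQs : ∀ i j, Q i j = Q j i := fun i j => by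
    rw [hQ, hQ, Finset.sum_comm]
    exact Finset.sum_congr rfl fun _ _ => Finset.sum_congr rfl fun _ _ => by rw [hTs]; ring
  have hPQ : ∀ i k, ∑ b, (G y)⁻¹ i b * lieMetric G V y b k = ∑ j, Q i j * G y j k := by
    intro i k
    have h1 : ∀ l, ∑ j, (G y)⁻¹ l j * G y j k = if l = k then 1 else 0 := fun l =>
      sum_inv_mul hd.ne' l k
    have h2 : ∑ j, Q i j * G y j k = ∑ b, (G y)⁻¹ i b * ∑ l, lieMetric G V y b l *
        ∑ j, (G y)⁻¹ l j * G y j k := by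
      simp only [hQ, inv_symm (hs y) 1 0, inv_symm (hs y) 2 0, inv_symm (hs y) 2 1,
        Fin.sum_univ_three]
      ring
    rw [h2]
    simp [h1]
  have hN : normSq (G y) (lieMetric G V y) = ∑ i, ∑ j, Q i j * lieMetric G V y i j := by
    simp only [normSq, hQ, Finset.sum_mul]
    exact Finset.sum_congr rfl fun _ _ => Finset.sum_congr rfl fun _ _ =>
      Finset.sum_congr rfl fun _ _ => Finset.sum_congr rfl fun _ _ => by ring
  have hL : ∀ i j, lieMetric G V y i j = ∑ k, (V y k * (∑ n, christoffel G n k i y * G y n j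
      + ∑ n, christoffel G n k j y * G y i n)
      + G y k j * pd i (fun z => V z k) y + G y i k * pd j (fun z => V z k) y) := by
    intro i j
    simp only [lieMetric, Matrix.of_apply, pd_metric hs hd.ne']
  rw [hN]
  have d0 := hdiv 0
  have d1 := hdiv 1
  have d2 := hdiv 2
  simp only [flux, hPQ] at d0 d1 d2 ⊢
  simp only [hL, Fin.sum_univ_three, hQs 1 0, hQs 2 0, hQs 2 1, hs y 1 0, hs y 2 0, hs y 2 1,
    fun n => christoffel_symm hs n 1 0 y, fun n => christoffel_symm hs n 2 0 y,
    fun n => christoffel_symm hs n 2 1 y] at d0 d1 d2 ⊢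
  linear_combination V y 0 * d0 + V y 1 * d1 + V y 2 * d2

end Local

/-! ### Behaviour under coordinate changes -/

/-- The Jacobian matrix `∂ᵢ φᵃ`. -/
def jac (φ : E3 → E3) (y : E3) : Matrix (Fin 3) (Fin 3) ℝ :=
  Matrix.of fun a i => pd i (fun z => φ z a) y

theorem fderiv_apply_coord {φ : E3 → E3} {y : E3} (hφ : DifferentiableAt ℝ φ y) (v : E3)
    (a : Fin 3) : fderiv ℝ φ y v a = fderiv ℝ (fun z => φ z a) y v := by
  have h := (EuclideanSpace.proj (𝕜 := ℝ) a).hasFDerivAt.comp y hφ.hasFDerivAt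
  have h2 : HasFDerivAt (fun z => φ z a) _ y := h
  rw [h2.fderiv]; rfl

theorem eq_sum_single (v : E3) : v = ∑ i, v i • EuclideanSpace.single i (1 : ℝ) := by
  ext j
  simp [Fin.sum_univ_three]
  fin_cases j <;> simp

theorem fderiv_eq_sum_pd {f : E3 → ℝ} (y v : E3) : fderiv ℝ f y v = ∑ i, v i * pd i f y := by
  conv_lhs => rw [eq_sum_single v, map_sum]
  simp [pd]

theorem fderiv_eq_jac {φ : E3 → E3} {y : E3} (hφ : DifferentiableAt ℝ φ y) (v : E3) (a : Fin 3) :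
    fderiv ℝ φ y v a = ∑ i, jac φ y a i * v i := by
  rw [fderiv_apply_coord hφ, fderiv_eq_sum_pd]
  simp only [jac, Matrix.of_apply, mul_comm]

theorem det_fderiv {φ : E3 → E3} {y : E3} (hφ : DifferentiableAt ℝ φ y) :
    (fderiv ℝ φ y).det = (jac φ y).det := by
  have : (fderiv ℝ φ y : E3 →ₗ[ℝ] E3) = Matrix.toLin (EuclideanSpace.basisFun (Fin 3) ℝ).toBasis
      (EuclideanSpace.basisFun (Fin 3) ℝ).toBasis (jac φ y) := by
    refine (EuclideanSpace.basisFun (Fin 3) ℝ).toBasis.ext fun i => ?_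
    rw [Matrix.toLin_self]
    ext a
    simp [fderiv_eq_jac hφ, Fin.sum_univ_three]
    fin_cases i <;> fin_cases a <;> simp
  rw [ContinuousLinearMap.det, this, LinearMap.det_toLin]

/-- The chain rule. -/
theorem pd_comp {f : E3 → ℝ} {φ : E3 → E3} {y : E3} (hf : DifferentiableAt ℝ f (φ y))
    (hφ : DifferentiableAt ℝ φ y) (i : Fin 3) :
    pd i (fun z => f (φ z)) y = ∑ c, jac φ y c i * pd c f (φ y) := by
  have h : HasFDerivAt (fun z => f (φ z)) _ y := hf.hasFDerivAt.comp y hφ.hasFDerivAt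
  rw [pd, h.fderiv, ContinuousLinearMap.comp_apply, fderiv_eq_sum_pd]
  -- The coordinates of the derivative of `φ` in the direction `i` form a column of `jac φ`.
  refine Finset.sum_congr rfl fun c _ => ?_
  rw [fderiv_apply_coord hφ]; rfl

theorem contDiffOn_coord {U : Set E3} {φ : E3 → E3} (hφ : ContDiffOn ℝ ∞ φ U) (a : Fin 3) :
    ContDiffOn ℝ ∞ (fun z => φ z a) U :=
  (EuclideanSpace.proj (𝕜 := ℝ) a).contDiff.comp_contDiffOn hφ

section Transform

variable {U U' : Set E3} {G G' : E3 → Matrix (Fin 3) (Fin 3) ℝ} {V V' : E3 → Fin 3 → ℝ}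
  {φ : E3 → E3}

/-- `ℒ_V g` is a tensor: if the metric and the vector field transform under a change of coordinates
`φ`, so does the Lie derivative. The terms with second derivatives of `φ` cancel. -/
theorem lieMetric_transform (hU : IsOpen U) (hU' : IsOpen U') (hφ : ContDiffOn ℝ ∞ φ U)
    (hm : MapsTo φ U U') (hG' : ∀ i j, ContDiffOn ℝ ∞ (fun y => G' y i j) U')
    (hV : ∀ i, ContDiffOn ℝ ∞ (fun y => V y i) U)
    (hV' : ∀ i, ContDiffOn ℝ ∞ (fun y => V' y i) U')
    (hGG : ∀ y ∈ U, G y = (jac φ y).transpose * G' (φ y) * jac φ y)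
    (hVV : ∀ y ∈ U, ∀ a, V' (φ y) a = ∑ i, jac φ y a i * V y i) {y : E3} (hy : y ∈ U) :
    lieMetric G V y = (jac φ y).transpose * lieMetric G' V' (φ y) * jac φ y := by
  have dφ : DifferentiableAt ℝ φ y := (hφ.contDiffAt (hU.mem_nhds hy)).differentiableAt (by simp)
  have sJ : ∀ a i, ContDiffOn ℝ ∞ (fun z => jac φ z a i) U :=
    fun a i => contDiffOn_pd hU (contDiffOn_coord hφ a) i
  have dJ : ∀ a i, DifferentiableAt ℝ (fun z => jac φ z a i) y :=
    fun a i => differentiableAt_of_contDiffOn hU (sJ a i) hy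
  have dG' : ∀ a b, DifferentiableAt ℝ (fun z => G' z a b) (φ y) :=
    fun a b => differentiableAt_of_contDiffOn hU' (hG' a b) (hm hy)
  have dV' : ∀ a, DifferentiableAt ℝ (fun z => V' z a) (φ y) :=
    fun a => differentiableAt_of_contDiffOn hU' (hV' a) (hm hy)
  have dV : ∀ a, DifferentiableAt ℝ (fun z => V z a) y :=
    fun a => differentiableAt_of_contDiffOn hU (hV a) hy
  have dGφ : ∀ a b, DifferentiableAt ℝ (fun z => G' (φ z) a b) y :=
    fun a b => (dG' a b).comp y dφ
  -- The second derivatives of the coordinate change are symmetric.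
  have hJs : ∀ a i j, pd i (fun z => jac φ z a j) y = pd j (fun z => jac φ z a i) y :=
    fun a i j => pd_comm (((contDiffOn_coord hφ a).contDiffAt (hU.mem_nhds hy)).of_le
      (by exact_mod_cast ENat.LEInfty.out)) i j
  have hGe : ∀ z ∈ U, ∀ i j, G z i j
      = ∑ b, ∑ a, jac φ z a i * (G' (φ z) a b * jac φ z b j) := by
    intro z hz i j
    rw [hGG z hz, Matrix.mul_apply]
    simp only [Matrix.mul_apply, Matrix.transpose_apply, Finset.sum_mul, mul_assoc]
  have hdG : ∀ k i j, pd k (fun z => G z i j) y = ∑ b, ∑ a,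
      (jac φ y a i * (G' (φ y) a b * pd k (fun z => jac φ z b j) y + jac φ y b j *
        ∑ c, jac φ y c k * pd c (fun z => G' z a b) (φ y))
        + G' (φ y) a b * jac φ y b j * pd k (fun z => jac φ z a i) y) := by
    intro k i j
    rw [EqOn.pd hU (fun z hz => hGe z hz i j) k hy]
    rw [pd_sum fun b => DifferentiableAt.fun_sum fun a _ =>
      (dJ a i).fun_mul ((dGφ a b).fun_mul (dJ b j))]
    refine Finset.sum_congr rfl fun b _ => ?_
    rw [pd_sum fun a => (dJ a i).fun_mul ((dGφ a b).fun_mul (dJ b j))]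
    refine Finset.sum_congr rfl fun a _ => ?_
    rw [pd_mul (dJ a i) ((dGφ a b).fun_mul (dJ b j)), pd_mul (dGφ a b) (dJ b j),
      pd_comp (f := fun z => G' z a b) (dG' a b) dφ]
  have hdV : ∀ a i, ∑ c, jac φ y c i * pd c (fun z => V' z a) (φ y)
      = ∑ k, (jac φ y a k * pd i (fun z => V z k) y + V y k * pd i (fun z => jac φ z a k) y) := by
    intro a i
    rw [← pd_comp (f := fun z => V' z a) (dV' a) dφ, EqOn.pd hU (fun z hz => hVV z hz a) i hy,
      pd_sum fun k => (dJ a k).fun_mul (dV k)]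
    exact Finset.sum_congr rfl fun k _ => pd_mul (dJ a k) (dV k) i
  ext i j
  simp only [Matrix.mul_apply, Matrix.transpose_apply]
  have hi := fun c => hdV c i
  have hj := fun c => hdV c j
  simp only [lieMetric, Matrix.of_apply, hdG, hGe y hy, hVV y hy]
  simp only [Fin.sum_univ_three, fun a => hJs a 0 i, fun a => hJs a 1 i, fun a => hJs a 2 i,
    fun a => hJs a 0 j, fun a => hJs a 1 j, fun a => hJs a 2 j] at hi hj ⊢
  generalize jac φ y = J at *
  generalize G' (φ y) = g at *
  linear_combination
    -(J 0 j * g 0 0 + J 1 j * g 0 1 + J 2 j * g 0 2) * hi 0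
    - (J 0 j * g 1 0 + J 1 j * g 1 1 + J 2 j * g 1 2) * hi 1
    - (J 0 j * g 2 0 + J 1 j * g 2 1 + J 2 j * g 2 2) * hi 2
    - (J 0 i * g 0 0 + J 1 i * g 1 0 + J 2 i * g 2 0) * hj 0
    - (J 0 i * g 0 1 + J 1 i * g 1 1 + J 2 i * g 2 1) * hj 1
    - (J 0 i * g 0 2 + J 1 i * g 1 2 + J 2 i * g 2 2) * hj 2

end Transform

theorem normSq_eq_trace (g T : Matrix (Fin 3) (Fin 3) ℝ) :
    normSq g T = (g⁻¹ * T * (g⁻¹).transpose * T.transpose).trace := by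
  simp only [normSq, Matrix.trace, Matrix.diag, Matrix.mul_apply, Matrix.transpose_apply,
    Fin.sum_univ_three]
  ring

/-- `|T|²` does not depend on the coordinates. -/
theorem normSq_transform {g T J : Matrix (Fin 3) (Fin 3) ℝ} (hJ : J.det ≠ 0) :
    normSq (J.transpose * g * J) (J.transpose * T * J) = normSq g T := by
  have hJ' : IsUnit J.det := isUnit_iff_ne_zero.2 hJ
  have hJt : IsUnit J.transpose.det := by rwa [Matrix.det_transpose]
  rw [normSq_eq_trace, normSq_eq_trace]
  simp only [Matrix.mul_inv_rev, Matrix.transpose_mul, Matrix.transpose_transpose, ← mul_assoc]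
  rw [← Matrix.transpose_nonsing_inv J, Matrix.transpose_transpose]
  have e1 : J⁻¹ * g⁻¹ * J⁻¹.transpose * J.transpose = J⁻¹ * g⁻¹ := by
    rw [mul_assoc, ← Matrix.transpose_mul, Matrix.mul_nonsing_inv _ hJ', Matrix.transpose_one,
      mul_one]
  have e2 : ∀ X : Matrix (Fin 3) (Fin 3) ℝ, X * J * J⁻¹ = X := fun X => by
    rw [mul_assoc, Matrix.mul_nonsing_inv _ hJ', mul_one]
  have e3 : ∀ X : Matrix (Fin 3) (Fin 3) ℝ, X * J⁻¹.transpose * J.transpose = X := fun X => by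
    rw [mul_assoc, ← Matrix.transpose_mul, Matrix.mul_nonsing_inv _ hJ', Matrix.transpose_one,
      mul_one]
  simp only [e3, e2]
  rw [Matrix.trace_mul_comm]
  simp only [← mul_assoc, Matrix.mul_nonsing_inv _ hJ', one_mul]

open scoped MatrixOrder Matrix.Norms.L2Operator in
/-- With `g⁻¹ = Bᵗ B` one has `|T|² = ∑ ((B T Bᵗ)_{ab})²`. -/
theorem normSq_nonneg_and_eq_zero {g : Matrix (Fin 3) (Fin 3) ℝ} (hg : g.PosDef)
    (T : Matrix (Fin 3) (Fin 3) ℝ) : 0 ≤ normSq g T ∧ (normSq g T = 0 → T = 0) := by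
  have hgi : g⁻¹.PosDef := hg.inv
  obtain ⟨B, hB⟩ : ∃ B : Matrix (Fin 3) (Fin 3) ℝ, g⁻¹ = B.transpose * B :=
    CStarAlgebra.nonneg_iff_eq_star_mul_self.1 hgi.posSemidef.nonneg
  have hBd : IsUnit B.det := by
    have h1 : g⁻¹.det ≠ 0 := hgi.det_pos.ne'
    rw [hB, Matrix.det_mul, Matrix.det_transpose] at h1
    exact isUnit_iff_ne_zero.2 (left_ne_zero_of_mul h1)
  have hN : normSq g T = ∑ a, ∑ b, ((B * T * B.transpose) a b) ^ 2 := by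
    have : normSq g T = ((B * T * B.transpose) * (B * T * B.transpose).transpose).trace := by
      rw [normSq_eq_trace, hB]
      simp only [Matrix.transpose_mul, Matrix.transpose_transpose]
      rw [mul_assoc B.transpose, mul_assoc B.transpose, mul_assoc B.transpose,
        Matrix.trace_mul_comm]
      simp only [← mul_assoc]
    rw [this]
    simp only [Matrix.trace, Matrix.diag, Matrix.mul_apply (N := (_ : Matrix _ _ ℝ).transpose),
      pow_two]
    rfl
  rw [hN]
  refine ⟨Finset.sum_nonneg fun a _ => Finset.sum_nonneg fun b _ => sq_nonneg _, fun h => ?_⟩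
  have h0 : B * T * B.transpose = 0 := by
    ext a b
    have h1 := (Finset.sum_eq_zero_iff_of_nonneg fun a _ =>
      Finset.sum_nonneg fun b _ => sq_nonneg _).1 h a (Finset.mem_univ _)
    have h2 := (Finset.sum_eq_zero_iff_of_nonneg fun b _ => sq_nonneg _).1 h1 b (Finset.mem_univ _)
    simpa using h2
  have hBt : IsUnit B.transpose.det := by rwa [Matrix.det_transpose]
  calc T = B⁻¹ * (B * T * B.transpose) * B.transpose⁻¹ := by
        rw [mul_assoc, mul_assoc (B * T), Matrix.mul_nonsing_inv _ hBt, mul_one, ← mul_assoc,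
          Matrix.nonsing_inv_mul _ hBd, one_mul]
    _ = 0 := by rw [h0]; simp

theorem flux_eq (G T : E3 → Matrix (Fin 3) (Fin 3) ℝ) (V : E3 → Fin 3 → ℝ) (y : E3) :
    (fun i => flux G T V i y) = ((G y)⁻¹ * T y).mulVec (V y) := by
  funext i
  simp only [flux, Matrix.mulVec, dotProduct, Matrix.mul_apply]

/-- `Tⁱⱼ Vʲ` transforms as a vector field. -/
theorem flux_transform {G G' T T' : E3 → Matrix (Fin 3) (Fin 3) ℝ} {V V' : E3 → Fin 3 → ℝ}
    {φ : E3 → E3} {y : E3} (hJ : (jac φ y).det ≠ 0)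
    (hG : G y = (jac φ y).transpose * G' (φ y) * jac φ y)
    (hT : T y = (jac φ y).transpose * T' (φ y) * jac φ y)
    (hV : ∀ a, V' (φ y) a = ∑ i, jac φ y a i * V y i) (c : Fin 3) :
    flux G' T' V' c (φ y) = ∑ i, jac φ y c i * flux G T V i y := by
  have hJ' : IsUnit (jac φ y).det := isUnit_iff_ne_zero.2 hJ
  have hV2 : V' (φ y) = (jac φ y).mulVec (V y) := funext hV
  have h := congrArg (jac φ y).mulVec (flux_eq G T V y)
  have h' := flux_eq G' T' V' (φ y)
  refine (congrFun h' c).trans (Eq.trans ?_ (congrFun h c).symm)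
  rw [hV2, hG, hT]
  simp only [Matrix.mulVec_mulVec, Matrix.mul_inv_rev]
  congr 1
  rw [← Matrix.transpose_nonsing_inv]
  have e1 : (jac φ y)⁻¹.transpose * (jac φ y).transpose = 1 := by
    rw [← Matrix.transpose_mul, Matrix.mul_nonsing_inv _ hJ', Matrix.transpose_one]
  simp only [← mul_assoc]
  rw [Matrix.mul_nonsing_inv _ hJ', one_mul, mul_assoc (G' (φ y))⁻¹ _ (jac φ y).transpose, e1,
    mul_one]

/-! ### Charts of a manifold -/

section Charts

variable {M : Type*} [TopologicalSpace M] [ChartedSpace E3 M] [IsManifold (𝓡 3) ∞ M]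

variable {e e' : OpenPartialHomeomorph M E3}

/-- The coordinate vector fields of a chart are smooth. -/
theorem contMDiffOn_tangent_symm (he : e ∈ IsManifold.maximalAtlas (𝓡 3) ∞ M) (v : E3) :
    ContMDiffOn (𝓡 3) (𝓡 3).tangent ∞ (fun y : E3 =>
      (⟨e.symm y, mfderiv (𝓡 3) (𝓡 3) e.symm y v⟩ : TangentBundle (𝓡 3) M)) e.target := by
  have h1 := (contMDiffOn_symm_of_mem_maximalAtlas he).contMDiffOn_tangentMapWithin (m := ∞)
    (by simp) e.open_target.uniqueMDiffOn
  have h2 : ContMDiff (𝓡 3) (𝓡 3).tangent ∞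
      (fun y : E3 => (⟨y, v⟩ : TangentBundle (𝓡 3) E3)) :=
    contMDiff_vectorSpace_iff_contDiff.2 contDiff_const
  have h3 := h1.comp h2.contMDiffOn (s := e.target) (fun y hy => hy)
  refine h3.congr fun y hy => ?_
  simp only [Function.comp, tangentMapWithin]
  rw [mfderivWithin_of_isOpen e.open_target hy]

theorem contDiffOn_metricCoeff (g : Metric M) (he : e ∈ IsManifold.maximalAtlas (𝓡 3) ∞ M)
    (i j : Fin 3) : ContDiffOn ℝ ∞ (fun y => metricCoeff g e y i j) e.target := by
  rw [← contMDiffOn_iff_contDiffOn]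
  have h1 := g.contMDiff.comp_contMDiffOn (contMDiffOn_symm_of_mem_maximalAtlas he)
  have h2 := ContMDiffOn.clm_bundle_apply₂ (F₃ := ℝ) (E₃ := Bundle.Trivial M ℝ) h1
    (contMDiffOn_tangent_symm he (EuclideanSpace.single i 1))
    (contMDiffOn_tangent_symm he (EuclideanSpace.single j 1))
  intro y hy
  have := h2 y hy
  rw [Bundle.contMDiffWithinAt_totalSpace] at this
  exact this.2

theorem metricCoeff_symm (g : Metric M) (e : OpenPartialHomeomorph M E3) (y : E3) (i j : Fin 3) :
    metricCoeff g e y i j = metricCoeff g e y j i := by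
  simp only [metricCoeff, Matrix.of_apply]
  exact g.symm _ _ _

theorem contDiffOn_vectorCoeff {X : (x : M) → TangentSpace (𝓡 3) x}
    (hX : ContMDiff (𝓡 3) (𝓡 3).tangent ∞ (fun x => (⟨x, X x⟩ : TangentBundle (𝓡 3) M)))
    (he : e ∈ IsManifold.maximalAtlas (𝓡 3) ∞ M) (i : Fin 3) :
    ContDiffOn ℝ ∞ (fun y => vectorCoeff X e y i) e.target := by
  have h1 := (contMDiffOn_of_mem_maximalAtlas he).contMDiffOn_tangentMapWithin (m := ∞)
    (by simp) e.open_source.uniqueMDiffOn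
  have h2 := hX.comp_contMDiffOn (contMDiffOn_symm_of_mem_maximalAtlas he)
  have h3 := h1.comp h2 (fun y hy => e.map_target hy)
  have h4 : ContDiffOn ℝ ∞ (fun y => (mfderiv (𝓡 3) (𝓡 3) e (e.symm y) (X (e.symm y)) : E3))
      e.target := by
    refine (contMDiffOn_vectorSpace_iff_contDiffOn (V := fun y =>
      (mfderiv (𝓡 3) (𝓡 3) e (e.symm y) (X (e.symm y)) : E3))).1 (h3.congr fun y hy => ?_)
    simp only [Function.comp, tangentMapWithin]
    rw [mfderivWithin_of_isOpen e.open_source (e.map_target hy)]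
    refine Bundle.TotalSpace.ext (e.right_inv hy).symm ?_
    exact HEq.rfl
  exact contDiffOn_coord h4 i

/-- The coordinate change from `e` to `e'`, meaningful on `overlap e e'`. -/
def coordChange (e e' : OpenPartialHomeomorph M E3) (y : E3) : E3 := e' (e.symm y)

/-- The domain of the coordinate change from `e` to `e'`: the points of the image of `e` that
correspond to points of the domain of `e'`. -/
def overlap (e e' : OpenPartialHomeomorph M E3) : Set E3 := (e.symm.trans e').source

theorem isOpen_overlap {M : Type*} [TopologicalSpace M] {e e' : OpenPartialHomeomorph M E3} :
    IsOpen (overlap e e') := (e.symm.trans e').open_source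

theorem mem_overlap {M : Type*} [TopologicalSpace M] {e e' : OpenPartialHomeomorph M E3}
    {y : E3} : y ∈ overlap e e' ↔ y ∈ e.target ∧ e.symm y ∈ e'.source := by
  simp [overlap]

theorem contDiffOn_coordChange {M : Type*} [TopologicalSpace M] [ChartedSpace E3 M]
    {e e' : OpenPartialHomeomorph M E3}
    (he : e ∈ IsManifold.maximalAtlas (𝓡 3) ∞ M)
    (he' : e' ∈ IsManifold.maximalAtlas (𝓡 3) ∞ M) :
    ContDiffOn ℝ ∞ (coordChange e e') (overlap e e') := by
  rw [← contMDiffOn_iff_contDiffOn]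
  exact (contMDiffOn_of_mem_maximalAtlas he').comp
    ((contMDiffOn_symm_of_mem_maximalAtlas he).mono fun y hy => (mem_overlap.1 hy).1)
    fun y hy => (mem_overlap.1 hy).2

theorem mfderiv_symm_coordChange {M : Type*} [TopologicalSpace M] [ChartedSpace E3 M]
    {e e' : OpenPartialHomeomorph M E3}
    (he : e ∈ IsManifold.maximalAtlas (𝓡 3) ∞ M)
    (he' : e' ∈ IsManifold.maximalAtlas (𝓡 3) ∞ M) {y : E3} (hy : y ∈ overlap e e') (v : E3) :
    (mfderiv (𝓡 3) (𝓡 3) e.symm y v : E3)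
      = (mfderiv (𝓡 3) (𝓡 3) e'.symm (coordChange e e' y)
        (fderiv ℝ (coordChange e e') y v : E3) : E3) := by
  obtain ⟨h1, h2⟩ := mem_overlap.1 hy
  have hd : MDifferentiableAt (𝓡 3) (𝓡 3) (coordChange e e') y :=
    (((contDiffOn_coordChange he he').contDiffAt (isOpen_overlap.mem_nhds hy)).differentiableAt
      (by simp)).mdifferentiableAt
  have hd' : MDifferentiableAt (𝓡 3) (𝓡 3) e'.symm (coordChange e e' y) :=
    (contMDiffAt_symm_of_mem_maximalAtlas he' (e'.map_source h2)).mdifferentiableAt (by simp)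
  have hE : e.symm =ᶠ[nhds y] e'.symm ∘ coordChange e e' := by
    filter_upwards [isOpen_overlap.mem_nhds hy] with z hz
    exact (e'.left_inv (mem_overlap.1 hz).2).symm
  rw [hE.mfderiv_eq, mfderiv_comp y hd' hd, mfderiv_eq_fderiv]
  rfl

theorem differentiableAt_coordChange {M : Type*} [TopologicalSpace M] [ChartedSpace E3 M]
    {e e' : OpenPartialHomeomorph M E3}
    (he : e ∈ IsManifold.maximalAtlas (𝓡 3) ∞ M)
    (he' : e' ∈ IsManifold.maximalAtlas (𝓡 3) ∞ M) {y : E3} (hy : y ∈ overlap e e') :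
    DifferentiableAt ℝ (coordChange e e') y :=
  ((contDiffOn_coordChange he he').contDiffAt (isOpen_overlap.mem_nhds hy)).differentiableAt
    (by simp)

theorem coordChange_mem_overlap {M : Type*} [TopologicalSpace M] {e e' : OpenPartialHomeomorph M E3}
    {y : E3} (hy : y ∈ overlap e e') :
    coordChange e e' y ∈ overlap e' e := by
  obtain ⟨h1, h2⟩ := mem_overlap.1 hy
  refine mem_overlap.2 ⟨e'.map_source h2, ?_⟩
  rw [coordChange, e'.left_inv h2]
  exact e.map_target h1

theorem symm_coordChange {M : Type*} [TopologicalSpace M] {e e' : OpenPartialHomeomorph M E3}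
    {y : E3} (hy : y ∈ overlap e e') :
    e'.symm (coordChange e e' y) = e.symm y :=
  e'.left_inv (mem_overlap.1 hy).2

theorem coordChange_coordChange {M : Type*} [TopologicalSpace M] {e e' : OpenPartialHomeomorph M E3}
    {y : E3} (hy : y ∈ overlap e e') :
    coordChange e' e (coordChange e e' y) = y := by
  rw [coordChange, symm_coordChange hy, e.right_inv (mem_overlap.1 hy).1]

theorem det_jac_coordChange {M : Type*} [TopologicalSpace M] [ChartedSpace E3 M]
    {e e' : OpenPartialHomeomorph M E3}
    (he : e ∈ IsManifold.maximalAtlas (𝓡 3) ∞ M)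
    (he' : e' ∈ IsManifold.maximalAtlas (𝓡 3) ∞ M) {y : E3} (hy : y ∈ overlap e e') :
    (jac (coordChange e e') y).det ≠ 0 := by
  have h1 := (differentiableAt_coordChange he' he (coordChange_mem_overlap hy)).hasFDerivAt.comp y
    (differentiableAt_coordChange he he' hy).hasFDerivAt
  have h2 : HasFDerivAt (coordChange e' e ∘ coordChange e e') (ContinuousLinearMap.id ℝ E3) y := by
    refine (hasFDerivAt_id y).congr_of_eventuallyEq ?_
    filter_upwards [isOpen_overlap.mem_nhds hy] with z hz
    exact coordChange_coordChange hz
  have h3 := congrArg ContinuousLinearMap.det (h1.unique h2)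
  have h4 : ((fderiv ℝ (coordChange e' e) (coordChange e e' y)).comp
        (fderiv ℝ (coordChange e e') y)).det
      = (fderiv ℝ (coordChange e' e) (coordChange e e' y)).det
        * (fderiv ℝ (coordChange e e') y).det := by
    simp only [ContinuousLinearMap.det, ContinuousLinearMap.toLinearMap_comp, LinearMap.det_comp]
  rw [h4, det_fderiv (differentiableAt_coordChange he he' hy)] at h3
  intro h0
  rw [h0, mul_zero] at h3
  simp [ContinuousLinearMap.det] at h3

/-- The metric on arbitrary vectors in a chart, expanded in the coordinate frame. -/
theorem metricCoeff_bilin (g : Metric M) (e : OpenPartialHomeomorph M E3) (y u v : E3) :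
    g.inner (e.symm y) (mfderiv (𝓡 3) (𝓡 3) e.symm y u) (mfderiv (𝓡 3) (𝓡 3) e.symm y v)
      = ∑ i, ∑ j, u i * v j * metricCoeff g e y i j := by
  have h : ∀ w : E3, mfderiv (𝓡 3) (𝓡 3) e.symm y w = ∑ i, w i •
      mfderiv (𝓡 3) (𝓡 3) e.symm y (EuclideanSpace.single i (1 : ℝ) : E3) := fun w => by
    conv_lhs => rw [eq_sum_single w]
    -- The tangent spaces are `ℝ³` only by unfolding their definition, whence `erw`.
    erw [map_sum]
    exact Finset.sum_congr rfl fun i _ => map_smul _ _ _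
  rw [h u, h v]
  simp only [map_sum, map_smul, FunLike.coe_sum, Finset.sum_apply, FunLike.coe_smul, Pi.smul_apply,
    smul_eq_mul, metricCoeff, Matrix.of_apply, Finset.mul_sum]
  rw [Finset.sum_comm]
  exact Finset.sum_congr rfl fun i _ => Finset.sum_congr rfl fun j _ => by ring

theorem metricCoeff_trans (g : Metric M) (he : e ∈ IsManifold.maximalAtlas (𝓡 3) ∞ M)
    (he' : e' ∈ IsManifold.maximalAtlas (𝓡 3) ∞ M) {y : E3} (hy : y ∈ overlap e e') :
    metricCoeff g e y = (jac (coordChange e e') y).transpose * metricCoeff g e' (coordChange e e' y)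
      * jac (coordChange e e') y := by
  ext i j
  have h1 := metricCoeff_bilin g e' (coordChange e e' y)
    (fderiv ℝ (coordChange e e') y (EuclideanSpace.single i 1))
    (fderiv ℝ (coordChange e e') y (EuclideanSpace.single j 1))
  have h2 : metricCoeff g e y i j = g.inner (e'.symm (coordChange e e' y))
      (mfderiv (𝓡 3) (𝓡 3) e'.symm (coordChange e e' y)
        (fderiv ℝ (coordChange e e') y (EuclideanSpace.single i 1)))
      (mfderiv (𝓡 3) (𝓡 3) e'.symm (coordChange e e' y)
        (fderiv ℝ (coordChange e e') y (EuclideanSpace.single j 1))) := by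
    have a := mfderiv_symm_coordChange he he' hy
    simp only [metricCoeff, Matrix.of_apply]
    have key : ∀ (p q : M) (hpq : p = q) (u v : E3),
        g.inner p (u : TangentSpace (𝓡 3) p) (v : TangentSpace (𝓡 3) p)
          = g.inner q (u : TangentSpace (𝓡 3) q) (v : TangentSpace (𝓡 3) q) := by
      rintro p q rfl u v; rfl
    refine Eq.trans ?_ (key _ _ (symm_coordChange hy).symm _ _)
    erw [a, a]
  have h3 : ∀ i a, fderiv ℝ (coordChange e e') y (EuclideanSpace.single i 1) a
      = jac (coordChange e e') y a i := fun i a => by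
    rw [fderiv_apply_coord (differentiableAt_coordChange he he' hy)]; rfl
  rw [h2, h1]
  simp only [h3, Matrix.mul_apply, Matrix.transpose_apply, Finset.sum_mul]
  rw [Finset.sum_comm]
  exact Finset.sum_congr rfl fun i _ => Finset.sum_congr rfl fun j _ => by ring

theorem vectorCoeff_trans {M : Type*} [TopologicalSpace M] [ChartedSpace E3 M]
    {e e' : OpenPartialHomeomorph M E3}
    (X : (x : M) → TangentSpace (𝓡 3) x)
    (he : e ∈ IsManifold.maximalAtlas (𝓡 3) ∞ M)
    (he' : e' ∈ IsManifold.maximalAtlas (𝓡 3) ∞ M) {y : E3} (hy : y ∈ overlap e e') (a : Fin 3) :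
    vectorCoeff X e' (coordChange e e' y) a = ∑ i, jac (coordChange e e') y a i * vectorCoeff X e y
      i := by
  obtain ⟨h1, h2⟩ := mem_overlap.1 hy
  have hd := differentiableAt_coordChange he he' hy
  have hx : e (e.symm y) = y := e.right_inv h1
  have hE : e' =ᶠ[nhds (e.symm y)] coordChange e e' ∘ e := by
    filter_upwards [e.open_source.mem_nhds (e.map_target h1)] with p hp
    simp only [Function.comp, coordChange, e.left_inv hp]
  have hd1 : MDifferentiableAt (𝓡 3) (𝓡 3) e (e.symm y) :=
    (contMDiffAt_of_mem_maximalAtlas he (e.map_target h1)).mdifferentiableAt (by simp)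
  have hd2 : MDifferentiableAt (𝓡 3) (𝓡 3) (coordChange e e') (e (e.symm y)) := by
    rw [hx]; exact hd.mdifferentiableAt
  have h3 : ∀ v : E3, (mfderiv (𝓡 3) (𝓡 3) e' (e.symm y) v : E3)
      = fderiv ℝ (coordChange e e') y (mfderiv (𝓡 3) (𝓡 3) e (e.symm y) v : E3) := by
    intro v
    rw [hE.mfderiv_eq, mfderiv_comp _ hd2 hd1, mfderiv_eq_fderiv, hx]
    rfl
  have h4 : vectorCoeff X e' (coordChange e e' y) a
      = @WithLp.ofLp 2 (Fin 3 → ℝ) (mfderiv (𝓡 3) (𝓡 3) e' (e.symm y) (X (e.symm y))) a := by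
    rw [vectorCoeff, symm_coordChange hy]
  rw [h4]
  erw [h3, fderiv_eq_jac hd]
  rfl

theorem metricCoeff_posDef (g : Metric M) (he : e ∈ IsManifold.maximalAtlas (𝓡 3) ∞ M) {y : E3}
    (hy : y ∈ e.target) : (metricCoeff g e y).PosDef := by
  refine Matrix.PosDef.of_dotProduct_mulVec_pos ?_ fun v hv => ?_
  · ext i j
    simpa using metricCoeff_symm g e y j i
  · have h1 := metricCoeff_bilin g e y (WithLp.toLp 2 v) (WithLp.toLp 2 v)
    have h2 : star v ⬝ᵥ (metricCoeff g e y).mulVec v = g.inner (e.symm y)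
        (mfderiv (𝓡 3) (𝓡 3) e.symm y (WithLp.toLp 2 v : E3))
        (mfderiv (𝓡 3) (𝓡 3) e.symm y (WithLp.toLp 2 v : E3)) := by
      rw [h1]
      simp only [dotProduct, Matrix.mulVec, Finset.mul_sum, star_trivial, Pi.star_apply]
      exact Finset.sum_congr rfl fun i _ => Finset.sum_congr rfl fun j _ => by ring
    rw [h2]
    refine g.pos _ _ fun h0 => hv ?_
    have hm : e.MDifferentiable (𝓡 3) (𝓡 3) :=
      ⟨(contMDiffOn_of_mem_maximalAtlas he).mdifferentiableOn (by simp),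
        (contMDiffOn_symm_of_mem_maximalAtlas he).mdifferentiableOn (by simp)⟩
    -- Definiteness of `g` on tangent vectors carries over to the coefficients because the
    -- differential of the chart is injective.
    have h3 := hm.symm.mfderiv_injective (x := y) hy (h0.trans (map_zero _).symm)
    exact congrArg (fun w : E3 => w.ofLp) h3

end Charts

/-! ### Integration in charts -/

section Euclidean

theorem integrableOn_of_compact {U K : Set E3} (hU : IsOpen U) (hK : IsCompact K) (hKU : K ⊆ U)
    {f : E3 → ℝ} (hf : ContinuousOn f U) (h0 : ∀ y ∈ U, y ∉ K → f y = 0) : IntegrableOn f U :=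
  ((hf.mono hKU).integrableOn_compact hK).of_forall_sdiff_eq_zero hU.measurableSet
    fun y hy => h0 y hy.1 hy.2

/-- A partial derivative of a smooth function on an open set that vanishes off a compact subset
integrates to zero: extend the function by zero and integrate by parts against the constant `1`. -/
theorem setIntegral_pd_eq_zero {U K : Set E3} (hU : IsOpen U) (hK : IsCompact K) (hKU : K ⊆ U)
    {f : E3 → ℝ} (hf : ContDiffOn ℝ ∞ f U) (h0 : ∀ y ∈ U, y ∉ K → f y = 0) (i : Fin 3) :
    IntegrableOn (pd i f) U ∧ ∫ y in U, pd i f y = 0 := by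
  have hz : ∀ y, y ∉ K → U.indicator f =ᶠ[nhds y] fun _ => 0 := fun y hy => by
    filter_upwards [hK.isClosed.isOpen_compl.mem_nhds hy] with z hz
    by_cases hzU : z ∈ U
    · rw [indicator_of_mem hzU, h0 z hzU hz]
    · rw [indicator_of_notMem hzU]
  have hs : ContDiff ℝ ∞ (U.indicator f) := by
    rw [contDiff_iff_contDiffAt]
    intro y
    by_cases hy : y ∈ U
    · refine (hf.contDiffAt (hU.mem_nhds hy)).congr_of_eventuallyEq ?_
      filter_upwards [hU.mem_nhds hy] with z hz
      exact indicator_of_mem hz f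
    · exact contDiffAt_const.congr_of_eventuallyEq (hz y fun h => hy (hKU h))
  have hc : HasCompactSupport (U.indicator f) := HasCompactSupport.intro hK fun y hy =>
    (hz y hy).self_of_nhds
  have hp : ∀ y, y ∉ K → pd i (U.indicator f) y = 0 := fun y hy => by
    simp [pd, (hz y hy).fderiv_eq]
  have hpd := contDiff_pd hs i
  have hE : EqOn (pd i (U.indicator f)) (pd i f) U :=
    EqOn.pd hU (fun z hz => indicator_of_mem hz f) i
  have hi : Integrable (pd i (U.indicator f)) :=
    hpd.continuous.integrable_of_hasCompactSupport (HasCompactSupport.intro hK hp)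
  have h1 : ∫ y, pd i (U.indicator f) y = 0 := by
    have := integral_mul_fderiv_eq_neg_fderiv_mul_of_integrable (μ := (volume : Measure E3))
      (f := fun _ => (1 : ℝ)) (g := U.indicator f) (v := EuclideanSpace.single i 1)
      (by simp) (by simp only [one_mul]; exact hi)
      (by simpa using hs.continuous.integrable_of_hasCompactSupport hc)
      (fun _ _ => differentiableAt_const _) (fun x _ => hs.differentiable (by simp) x)
    simpa [pd] using this
  refine ⟨hi.integrableOn.congr_fun hE hU.measurableSet, ?_⟩
  rw [← setIntegral_congr_fun hU.measurableSet hE, setIntegral_eq_integral_of_forall_compl_eq_zero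
    fun y hy => hp y fun h => hy (hKU h), h1]

theorem eqOn_zero_of_setIntegral_eq_zero {U : Set E3} (hU : IsOpen U) {f : E3 → ℝ}
    (hf : ContinuousOn f U) (hi : IntegrableOn f U) (hn : ∀ y ∈ U, 0 ≤ f y)
    (h0 : ∫ y in U, f y = 0) : EqOn f 0 U := by
  have h1 := (setIntegral_eq_zero_iff_of_nonneg_ae
    ((ae_restrict_iff' hU.measurableSet).2 (Filter.Eventually.of_forall hn)) hi).1 h0
  exact Measure.eqOn_open_of_ae_eq h1 hU hf continuousOn_const

end Euclidean

section Charts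

variable {M : Type*} [TopologicalSpace M] [ChartedSpace E3 M] [IsManifold (𝓡 3) ∞ M]

variable {e e' : OpenPartialHomeomorph M E3}

/-- The density `√(det g)`. -/
def density (g : Metric M) (e : OpenPartialHomeomorph M E3) (y : E3) : ℝ :=
  Real.sqrt (metricCoeff g e y).det

theorem image_coordChange {M : Type*} [TopologicalSpace M] {e e' : OpenPartialHomeomorph M E3} :
    coordChange e e' '' overlap e e' = overlap e' e := by
  ext z
  constructor
  · rintro ⟨y, hy, rfl⟩; exact coordChange_mem_overlap hy
  · exact fun hz => ⟨coordChange e' e z, coordChange_mem_overlap hz, coordChange_coordChange hz⟩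

theorem density_trans (g : Metric M) (he : e ∈ IsManifold.maximalAtlas (𝓡 3) ∞ M)
    (he' : e' ∈ IsManifold.maximalAtlas (𝓡 3) ∞ M) {y : E3} (hy : y ∈ overlap e e') :
    density g e y = |(fderiv ℝ (coordChange e e') y).det| * density g e' (coordChange e e' y) := by
  rw [density, density, metricCoeff_trans g he he' hy, det_fderiv (differentiableAt_coordChange he
    he' hy)]
  rw [Matrix.det_mul, Matrix.det_mul, Matrix.det_transpose, mul_comm, ← mul_assoc, ← pow_two,
    Real.sqrt_mul (sq_nonneg _), Real.sqrt_sq_eq_abs]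

/-- The integral of a function over the part common to two charts can be computed in either of
them. -/
theorem integral_overlap (g : Metric M) (he : e ∈ IsManifold.maximalAtlas (𝓡 3) ∞ M)
    (he' : e' ∈ IsManifold.maximalAtlas (𝓡 3) ∞ M) {f f' : E3 → ℝ}
    (hf : ∀ y ∈ overlap e e', f y = f' (coordChange e e' y)) :
    ∫ y in overlap e e', f y * density g e y = ∫ z in overlap e' e, f' z * density g e' z := by
  rw [← image_coordChange (e := e) (e' := e'), integral_image_eq_integral_abs_det_fderiv_smul volume
    isOpen_overlap.measurableSet (f' := fun y => fderiv ℝ (coordChange e e') y)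
    (fun y hy => (differentiableAt_coordChange he he' hy).hasFDerivAt.hasFDerivWithinAt)
    (fun y hy z hz h => by rw [← coordChange_coordChange hy, h, coordChange_coordChange hz])]
  refine setIntegral_congr_fun isOpen_overlap.measurableSet fun y hy => ?_
  simp only [smul_eq_mul]
  rw [hf y hy, density_trans g he he' hy]
  ring

variable (g : Metric M) {X : (x : M) → TangentSpace (𝓡 3) x}

theorem lieCoeff_trans
    (hX : ContMDiff (𝓡 3) (𝓡 3).tangent ∞ (fun x => (⟨x, X x⟩ : TangentBundle (𝓡 3) M)))
    (he : e ∈ IsManifold.maximalAtlas (𝓡 3) ∞ M)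
    (he' : e' ∈ IsManifold.maximalAtlas (𝓡 3) ∞ M) {y : E3} (hy : y ∈ overlap e e') :
    lieCoeff g X e y = (jac (coordChange e e') y).transpose * lieCoeff g X e' (coordChange e e' y)
      * jac (coordChange e e') y :=
  lieMetric_transform isOpen_overlap e'.open_target (contDiffOn_coordChange he he')
    (fun _ hz => (mem_overlap.1 (coordChange_mem_overlap hz)).1) (contDiffOn_metricCoeff g he')
    (fun i => (contDiffOn_vectorCoeff hX he i).mono fun _ hz => (mem_overlap.1 hz).1)
    (contDiffOn_vectorCoeff hX he') (fun _ hz => metricCoeff_trans g he he' hz)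
    (fun _ hz => vectorCoeff_trans X he he' hz) hy

/-- `|ℒ_X g|²` is computed in the preferred chart at each point; by tensoriality any other chart of
the smooth structure gives the same value. -/
theorem lieNormSq_symm_apply
    (hX : ContMDiff (𝓡 3) (𝓡 3).tangent ∞ (fun x => (⟨x, X x⟩ : TangentBundle (𝓡 3) M)))
    (he : e ∈ IsManifold.maximalAtlas (𝓡 3) ∞ M) {y : E3} (hy : y ∈ e.target) :
    lieNormSq g X (e.symm y) = normSq (metricCoeff g e y) (lieCoeff g X e y) := by
  have he' : chartAt E3 (e.symm y) ∈ IsManifold.maximalAtlas (𝓡 3) ∞ M :=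
    IsManifold.chart_mem_maximalAtlas _
  have hy' : y ∈ overlap e (chartAt E3 (e.symm y)) :=
    mem_overlap.2 ⟨hy, mem_chart_source _ _⟩
  rw [lieCoeff_trans g hX he he' hy', metricCoeff_trans g he he' hy',
    normSq_transform (det_jac_coordChange he he' hy')]
  rfl

theorem lieNormSq_nonneg (p : M) : 0 ≤ lieNormSq g X p :=
  (normSq_nonneg_and_eq_zero (metricCoeff_posDef g (IsManifold.chart_mem_maximalAtlas p)
    ((chartAt E3 p).map_source (mem_chart_source E3 p))) _).1

theorem contDiffOn_normSq
    (hX : ContMDiff (𝓡 3) (𝓡 3).tangent ∞ (fun x => (⟨x, X x⟩ : TangentBundle (𝓡 3) M)))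
    (he : e ∈ IsManifold.maximalAtlas (𝓡 3) ∞ M) :
    ContDiffOn ℝ ∞ (fun y => normSq (metricCoeff g e y) (lieCoeff g X e y)) e.target := by
  have h1 := contDiffOn_inv (contDiffOn_metricCoeff g he)
    fun y hy => (metricCoeff_posDef g he hy).det_pos.ne'
  have h2 := contDiffOn_lieMetric e.open_target (contDiffOn_metricCoeff g he)
    (contDiffOn_vectorCoeff hX he)
  exact ContDiffOn.sum fun i _ => ContDiffOn.sum fun j _ => ContDiffOn.sum fun k _ =>
    ContDiffOn.sum fun l _ => (((h1 i k).mul (h1 j l)).mul (h2 i j)).mul (h2 k l)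

theorem continuous_lieNormSq
    (hX : ContMDiff (𝓡 3) (𝓡 3).tangent ∞ (fun x => (⟨x, X x⟩ : TangentBundle (𝓡 3) M))) :
    Continuous (lieNormSq g X) := by
  rw [continuous_iff_continuousAt]
  intro p
  have he : chartAt E3 p ∈ IsManifold.maximalAtlas (𝓡 3) ∞ M :=
    IsManifold.chart_mem_maximalAtlas p
  have hp := mem_chart_source E3 p
  have h1 := ((contDiffOn_normSq g hX he).continuousOn.continuousAt
    ((chartAt E3 p).open_target.mem_nhds ((chartAt E3 p).map_source hp))).comp
    ((chartAt E3 p).continuousAt hp)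
  refine h1.congr ?_
  filter_upwards [(chartAt E3 p).open_source.mem_nhds hp] with q hq
  simp only [Function.comp]
  rw [← lieNormSq_symm_apply g hX he ((chartAt E3 p).map_source hq), (chartAt E3 p).left_inv hq]

theorem contDiffOn_density (he : e ∈ IsManifold.maximalAtlas (𝓡 3) ∞ M) :
    ContDiffOn ℝ ∞ (density g e) e.target :=
  (contDiffOn_det (contDiffOn_metricCoeff g he)).sqrt
    fun _ hy => (metricCoeff_posDef g he hy).det_pos.ne'

/-- The derivative of a function `u` along the vector field `(ℒ_X g)ⁱⱼ Xʲ`, computed in the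
chart `e`. -/
def fluxDeriv (g : Metric M) (X : (x : M) → TangentSpace (𝓡 3) x)
    (e : OpenPartialHomeomorph M E3) (u : M → ℝ) (y : E3) : ℝ :=
  ∑ i, flux (metricCoeff g e) (lieCoeff g X e) (vectorCoeff X e) i y
    * pd i (fun z => u (e.symm z)) y

theorem contDiffOn_comp_symm {M : Type*} [TopologicalSpace M] [ChartedSpace E3 M]
    {e : OpenPartialHomeomorph M E3}
    (he : e ∈ IsManifold.maximalAtlas (𝓡 3) ∞ M) {u : M → ℝ}
    (hu : ContMDiff (𝓡 3) 𝓘(ℝ) ∞ u) : ContDiffOn ℝ ∞ (fun z => u (e.symm z)) e.target := by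
  rw [← contMDiffOn_iff_contDiffOn]
  exact hu.comp_contMDiffOn (contMDiffOn_symm_of_mem_maximalAtlas he)

theorem contDiffOn_flux_coeff
    (hX : ContMDiff (𝓡 3) (𝓡 3).tangent ∞ (fun x => (⟨x, X x⟩ : TangentBundle (𝓡 3) M)))
    (he : e ∈ IsManifold.maximalAtlas (𝓡 3) ∞ M) (i : Fin 3) : ContDiffOn ℝ ∞
      (flux (metricCoeff g e) (lieCoeff g X e) (vectorCoeff X e) i) e.target :=
  contDiffOn_flux (contDiffOn_metricCoeff g he)
    (contDiffOn_lieMetric e.open_target (contDiffOn_metricCoeff g he)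
      (contDiffOn_vectorCoeff hX he))
    (fun _ hy => (metricCoeff_posDef g he hy).det_pos.ne') (contDiffOn_vectorCoeff hX he) i

theorem contDiffOn_fluxDeriv
    (hX : ContMDiff (𝓡 3) (𝓡 3).tangent ∞ (fun x => (⟨x, X x⟩ : TangentBundle (𝓡 3) M)))
    (he : e ∈ IsManifold.maximalAtlas (𝓡 3) ∞ M) {u : M → ℝ} (hu : ContMDiff (𝓡 3) 𝓘(ℝ) ∞ u) :
    ContDiffOn ℝ ∞ (fluxDeriv g X e u) e.target :=
  ContDiffOn.sum fun i _ => (contDiffOn_flux_coeff g hX he i).mul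
    (contDiffOn_pd e.open_target (contDiffOn_comp_symm he hu) i)

theorem fluxDeriv_trans
    (hX : ContMDiff (𝓡 3) (𝓡 3).tangent ∞ (fun x => (⟨x, X x⟩ : TangentBundle (𝓡 3) M)))
    (he : e ∈ IsManifold.maximalAtlas (𝓡 3) ∞ M)
    (he' : e' ∈ IsManifold.maximalAtlas (𝓡 3) ∞ M) {u : M → ℝ} (hu : ContMDiff (𝓡 3) 𝓘(ℝ) ∞ u)
    {y : E3} (hy : y ∈ overlap e e') :
    fluxDeriv g X e u y = fluxDeriv g X e' u (coordChange e e' y) := by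
  have hd := differentiableAt_coordChange he he' hy
  have h1 : ∀ i, pd i (fun z => u (e.symm z)) y
      = ∑ c, jac (coordChange e e') y c i * pd c (fun z => u (e'.symm z)) (coordChange e e' y) :=
        fun i => by
    rw [← pd_comp (f := fun z => u (e'.symm z)) (differentiableAt_of_contDiffOn e'.open_target
      (contDiffOn_comp_symm he' hu) (mem_overlap.1 (coordChange_mem_overlap hy)).1) hd]
    exact EqOn.pd isOpen_overlap (fun z hz => by simp only [symm_coordChange hz]) i hy
  have h2 := flux_transform (det_jac_coordChange he he' hy) (metricCoeff_trans g he he' hy)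
    (lieCoeff_trans g hX he he' hy) (vectorCoeff_trans X he he' hy)
  simp only [fluxDeriv, h1, h2, Finset.mul_sum, Finset.sum_mul]
  rw [Finset.sum_comm]
  exact Finset.sum_congr rfl fun _ _ => Finset.sum_congr rfl fun _ _ => by ring

theorem fluxDeriv_eq_zero {u : M → ℝ} {y : E3} (hy : y ∈ e.target)
    (hu : e.symm y ∉ tsupport u) : fluxDeriv g X e u y = 0 := by
  have : (fun z => u (e.symm z)) =ᶠ[nhds y] fun _ => 0 := by
    filter_upwards [(e.continuousAt_symm hy).preimage_mem_nhds
      ((isClosed_tsupport u).isOpen_compl.mem_nhds hu)] with z hz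
    exact image_eq_zero_of_notMem_tsupport hz
  simp [fluxDeriv, pd, this.fderiv_eq]

/-- The divergence theorem for the vector field `Y = (ℒ_X g)ⁱⱼ Xʲ`, with divergence `½ |ℒ_X g|²`,
against a function `u` supported in a chart: `∫ u |ℒ_X g|² = -2 ∫ Y(u)`. -/
theorem integral_mul_lieNormSq
    (hX : ContMDiff (𝓡 3) (𝓡 3).tangent ∞ (fun x => (⟨x, X x⟩ : TangentBundle (𝓡 3) M)))
    (hK : IsKSoliton g X) (he : e ∈ IsManifold.maximalAtlas (𝓡 3) ∞ M) {u : M → ℝ}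
    (hu : ContMDiff (𝓡 3) 𝓘(ℝ) ∞ u) (hc : IsCompact (tsupport u)) (hs : tsupport u ⊆ e.source) :
    ∫ y in e.target, u (e.symm y) * density g e y * lieNormSq g X (e.symm y)
      = -2 * ∫ y in e.target, fluxDeriv g X e u y * density g e y := by
  set Y := fun i y => density g e y *
    flux (metricCoeff g e) (lieCoeff g X e) (vectorCoeff X e) i y with hY
  have hYs : ∀ i, ContDiffOn ℝ ∞ (Y i) e.target := fun i =>
    (contDiffOn_density g he).mul (contDiffOn_flux_coeff g hX he i)
  have hus := contDiffOn_comp_symm he hu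
  have hKc : IsCompact (e '' tsupport u) := hc.image_of_continuousOn (e.continuousOn.mono hs)
  have hKt : e '' tsupport u ⊆ e.target := by
    rintro _ ⟨p, hp, rfl⟩; exact e.map_source (hs hp)
  have hout : ∀ y ∈ e.target, y ∉ e '' tsupport u → e.symm y ∉ tsupport u := fun y hy h h' =>
    h ⟨_, h', e.right_inv hy⟩
  have hu0 : ∀ y ∈ e.target, y ∉ e '' tsupport u → u (e.symm y) = 0 := fun y hy h =>
    image_eq_zero_of_notMem_tsupport (hout y hy h)
  have h1 := fun i => setIntegral_pd_eq_zero e.open_target hKc hKt (hus.mul (hYs i))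
    (fun y hy h => by simp only [hu0 y hy h, zero_mul]) i
  have h2 : ∫ y in e.target, ∑ i, pd i (fun y => u (e.symm y) * Y i y) y = 0 := by
    rw [integral_finsetSum _ fun i _ => (h1 i).1]
    exact Finset.sum_eq_zero fun i _ => (h1 i).2
  have h3 : EqOn (fun y => ∑ i, pd i (fun y => u (e.symm y) * Y i y) y)
      (fun y => 1 / 2 * (u (e.symm y) * density g e y * lieNormSq g X (e.symm y))
        + fluxDeriv g X e u y * density g e y) e.target := by
    intro y hy
    have d1 := differentiableAt_of_contDiffOn e.open_target hus hy
    have d2 := fun i => differentiableAt_of_contDiffOn e.open_target (hYs i) hy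
    have h4 := div_flux e.open_target (contDiffOn_metricCoeff g he)
      (fun y => metricCoeff_symm g e y) (fun y => metricCoeff_posDef g he)
      (contDiffOn_vectorCoeff hX he) (fun y hy => hK e he y hy) hy
    have h5 : ∑ i, pd i (Y i) y = density g e y * (1 / 2 * lieNormSq g X (e.symm y)) := by
      rw [lieNormSq_symm_apply g hX he hy]; exact h4
    have h6 : ∀ i, pd i (fun y => u (e.symm y) * Y i y) y
        = u (e.symm y) * pd i (Y i) y + Y i y * pd i (fun y => u (e.symm y)) y :=
      fun i => pd_mul d1 (d2 i) i
    simp only [h6, Finset.sum_add_distrib, ← Finset.mul_sum, h5, fluxDeriv, Finset.sum_mul]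
    congr 1
    · ring
    · exact Finset.sum_congr rfl fun i _ => by simp only [hY]; ring
  have i1 : IntegrableOn (fun y => u (e.symm y) * density g e y * lieNormSq g X (e.symm y))
      e.target := integrableOn_of_compact e.open_target hKc hKt
    ((hus.continuousOn.mul (contDiffOn_density g he).continuousOn).mul
      ((continuous_lieNormSq g hX).comp_continuousOn e.continuousOn_symm))
    (fun y hy h => by simp only [hu0 y hy h, zero_mul])
  have i2 : IntegrableOn (fun y => fluxDeriv g X e u y * density g e y) e.target :=
    integrableOn_of_compact e.open_target hKc hKt
    ((contDiffOn_fluxDeriv g hX he hu).continuousOn.mul (contDiffOn_density g he).continuousOn)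
    (fun y hy h => by simp only [fluxDeriv_eq_zero g hy (hout y hy h), zero_mul])
  rw [setIntegral_congr_fun e.open_target.measurableSet h3, integral_add (i1.const_mul _) i2,
    integral_const_mul] at h2
  linarith

end Charts

/-! ### Integration over a compact manifold -/

section Compact

variable {M : Type*} [TopologicalSpace M] [ChartedSpace E3 M] [IsManifold (𝓡 3) ∞ M]
  [T2Space M] [CompactSpace M]

theorem tsupport_chartPartition (p : M) :
    tsupport (chartPartition M p) ⊆ (chartAt E3 p).source :=
  (SmoothPartitionOfUnity.exists_isSubordinate_chartAt_source (𝓡 3) M).choose_spec p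

/-- On a compact manifold only finitely many functions of the partition of unity are non-zero. -/
theorem exists_finset_chartPartition : ∃ P : Finset M,
    (∀ p, p ∉ P → ∀ q, chartPartition M p q = 0) ∧ ∀ q, ∑ p ∈ P, chartPartition M p q = 1 := by
  have hf := (chartPartition M).locallyFinite.finite_nonempty_of_compact
  refine ⟨hf.toFinset, fun p hp q => ?_, fun q => ?_⟩
  · by_contra h
    exact hp (hf.mem_toFinset.2 ⟨q, h⟩)
  · rw [← (chartPartition M).sum_eq_one (mem_univ q)]
    refine (finsum_eq_sum_of_support_subset _ fun p hp => ?_).symm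
    exact hf.mem_toFinset.2 ⟨q, hp⟩

section Pieces

variable (g : Metric M) (p : M)

theorem isCompact_image_tsupport :
    IsCompact (chartAt E3 p '' tsupport (chartPartition M p)) :=
  (isClosed_tsupport _).isCompact.image_of_continuousOn
    ((chartAt E3 p).continuousOn.mono (tsupport_chartPartition p))

theorem image_tsupport_subset :
    chartAt E3 p '' tsupport (chartPartition M p) ⊆ (chartAt E3 p).target := by
  rintro _ ⟨q, hq, rfl⟩
  exact (chartAt E3 p).map_source (tsupport_chartPartition p hq)

theorem symm_notMem_tsupport {y : E3} (hy : y ∈ (chartAt E3 p).target)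
    (h : y ∉ chartAt E3 p '' tsupport (chartPartition M p)) :
    (chartAt E3 p).symm y ∉ tsupport (chartPartition M p) :=
  fun h' => h ⟨_, h', (chartAt E3 p).right_inv hy⟩

theorem integrableOn_partition_mul {f : E3 → ℝ} (hf : ContinuousOn f (chartAt E3 p).target) :
    IntegrableOn (fun y => chartPartition M p ((chartAt E3 p).symm y)
      * density g (chartAt E3 p) y * f y) (chartAt E3 p).target :=
  integrableOn_of_compact (chartAt E3 p).open_target (isCompact_image_tsupport p)
    (image_tsupport_subset p)
    ((((chartPartition M p).contMDiff.continuous.comp_continuousOn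
      (chartAt E3 p).continuousOn_symm).mul
      (contDiffOn_density g (IsManifold.chart_mem_maximalAtlas p)).continuousOn).mul hf)
    fun y hy h => by
      rw [image_eq_zero_of_notMem_tsupport (symm_notMem_tsupport p hy h), zero_mul, zero_mul]

variable [MeasurableSpace M]

/-- The part of the Riemannian volume carried by one function of the partition of unity. -/
def volumePiece : Measure M :=
  Measure.map (chartAt E3 p).symm
    (((volume : Measure E3).restrict (chartAt E3 p).target).withDensity fun y =>
      ENNReal.ofReal (chartPartition M p ((chartAt E3 p).symm y) *
        Real.sqrt (metricCoeff g (chartAt E3 p) y).det))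

/-- The sum over all points of `M` that defines the Riemannian volume is a finite one. -/
theorem riemannianVolume_eq_sum {P : Finset M}
    (hP : ∀ p, p ∉ P → ∀ q, chartPartition M p q = 0) :
    riemannianVolume g = ∑ p ∈ P, volumePiece g p := by
  have h0 : ∀ p, p ∉ P → volumePiece g p = 0 := fun p hp => by
    simp [volumePiece, hP p hp]
  ext s hs
  rw [riemannianVolume, Measure.sum_apply _ hs, Measure.finsetSum_apply]
  refine tsum_eq_sum fun p hp => ?_
  exact congrArg (fun μ : Measure M => μ s) (h0 p hp)

variable [BorelSpace M]

theorem integral_volumePiece {f : M → ℝ} (hf : Continuous f) :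
    Integrable f (volumePiece g p) ∧ ∫ q, f q ∂(volumePiece g p)
      = ∫ y in (chartAt E3 p).target, chartPartition M p ((chartAt E3 p).symm y)
        * density g (chartAt E3 p) y * f ((chartAt E3 p).symm y) := by
  have hm := (chartAt E3 p).open_target.measurableSet
  have h1 : AEMeasurable (fun y => ENNReal.ofReal (chartPartition M p ((chartAt E3 p).symm y) *
      Real.sqrt (metricCoeff g (chartAt E3 p) y).det))
      ((volume : Measure E3).restrict (chartAt E3 p).target) := by
    refine (ContinuousOn.aemeasurable ?_ hm).ennreal_ofReal
    exact ((chartPartition M p).contMDiff.continuous.comp_continuousOn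
      (chartAt E3 p).continuousOn_symm).mul
      (contDiffOn_density g (IsManifold.chart_mem_maximalAtlas p)).continuousOn
  have h2 : AEMeasurable (chartAt E3 p).symm
      (((volume : Measure E3).restrict (chartAt E3 p).target).withDensity fun y =>
      ENNReal.ofReal (chartPartition M p ((chartAt E3 p).symm y) *
        Real.sqrt (metricCoeff g (chartAt E3 p) y).det)) :=
    ((chartAt E3 p).continuousOn_symm.aemeasurable hm).mono_ac
      (withDensity_absolutelyContinuous _ _)
  have h3 : ∀ᵐ y ∂(volume : Measure E3).restrict (chartAt E3 p).target,
      ENNReal.ofReal (chartPartition M p ((chartAt E3 p).symm y) *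
        Real.sqrt (metricCoeff g (chartAt E3 p) y).det) < ⊤ :=
    Filter.Eventually.of_forall fun _ => ENNReal.ofReal_lt_top
  have h4 : ∀ y, (ENNReal.ofReal (chartPartition M p ((chartAt E3 p).symm y) *
        Real.sqrt (metricCoeff g (chartAt E3 p) y).det)).toReal • f ((chartAt E3 p).symm y)
      = chartPartition M p ((chartAt E3 p).symm y)
        * density g (chartAt E3 p) y * f ((chartAt E3 p).symm y) := fun y => by
    rw [ENNReal.toReal_ofReal (mul_nonneg ((chartPartition M).nonneg _ _) (Real.sqrt_nonneg _))]
    rfl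
  constructor
  · rw [volumePiece, integrable_map_measure hf.aestronglyMeasurable h2,
      integrable_withDensity_iff_integrable_smul₀' h1 h3]
    simp only [Function.comp, h4]
    exact integrableOn_partition_mul g p (hf.comp_continuousOn (chartAt E3 p).continuousOn_symm)
  · rw [volumePiece, integral_map h2 hf.aestronglyMeasurable,
      integral_withDensity_eq_integral_toReal_smul₀ h1 h3]
    simp only [h4]

end Pieces

variable (g : Metric M) {X : (x : M) → TangentSpace (𝓡 3) x}

/-- The function `ρₚ Y(ρ_q)`, where `ρ` is the partition of unity, is supported in the domains of
both charts `p` and `q`, and its integral may be computed in either. -/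
theorem integral_partition_fluxDeriv
    (hX : ContMDiff (𝓡 3) (𝓡 3).tangent ∞ (fun x => (⟨x, X x⟩ : TangentBundle (𝓡 3) M)))
    (p q : M) :
    ∫ y in (chartAt E3 q).target, chartPartition M p ((chartAt E3 q).symm y)
        * fluxDeriv g X (chartAt E3 q) (chartPartition M q) y * density g (chartAt E3 q) y
      = ∫ y in (chartAt E3 p).target, chartPartition M p ((chartAt E3 p).symm y)
        * fluxDeriv g X (chartAt E3 p) (chartPartition M q) y * density g (chartAt E3 p) y := by
  have hp : chartAt E3 p ∈ IsManifold.maximalAtlas (𝓡 3) ∞ M := IsManifold.chart_mem_maximalAtlas p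
  have hq : chartAt E3 q ∈ IsManifold.maximalAtlas (𝓡 3) ∞ M := IsManifold.chart_mem_maximalAtlas q
  have h1 := integral_overlap g hq hp
    (f := fun y => chartPartition M p ((chartAt E3 q).symm y)
      * fluxDeriv g X (chartAt E3 q) (chartPartition M q) y)
    (f' := fun y => chartPartition M p ((chartAt E3 p).symm y)
      * fluxDeriv g X (chartAt E3 p) (chartPartition M q) y)
    (fun y hy => by
      rw [fluxDeriv_trans g hX hq hp (chartPartition M q).contMDiff hy, symm_coordChange hy])
  rw [setIntegral_eq_of_subset_of_forall_sdiff_eq_zero (chartAt E3 q).open_target.measurableSet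
    (s := overlap (chartAt E3 q) (chartAt E3 p)) (fun y hy => (mem_overlap.1 hy).1), h1,
    setIntegral_eq_of_subset_of_forall_sdiff_eq_zero (chartAt E3 p).open_target.measurableSet
    (s := overlap (chartAt E3 p) (chartAt E3 q)) (fun y hy => (mem_overlap.1 hy).1)]
  · rintro y ⟨hy, hn⟩
    have : (chartAt E3 p).symm y ∉ tsupport (chartPartition M q) := fun h =>
      hn (mem_overlap.2 ⟨hy, tsupport_chartPartition q h⟩)
    rw [fluxDeriv_eq_zero g hy this, mul_zero, zero_mul]
  · rintro y ⟨hy, hn⟩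
    have : (chartAt E3 q).symm y ∉ tsupport (chartPartition M p) := fun h =>
      hn (mem_overlap.2 ⟨hy, tsupport_chartPartition p h⟩)
    rw [image_eq_zero_of_notMem_tsupport this, zero_mul, zero_mul]

/-- `∫ |ℒ_X g|² = 0`, written out with the partition of unity. With `Y` the vector field
`(ℒ_X g)ⁱⱼ Xʲ`, the sum is `-2 ∑_q ∫ Y(ρ_q) = -2 ∑ₚ ∑_q ∫ ρₚ Y(ρ_q)`, where the terms may be
integrated in the chart `p` and `∑_q Y(ρ_q) = Y(1) = 0`. -/
theorem sum_integral_eq_zero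
    (hX : ContMDiff (𝓡 3) (𝓡 3).tangent ∞ (fun x => (⟨x, X x⟩ : TangentBundle (𝓡 3) M)))
    (hK : IsKSoliton g X) {P : Finset M} (hP : ∀ q, ∑ p ∈ P, chartPartition M p q = 1) :
    ∑ q ∈ P, ∫ y in (chartAt E3 q).target, chartPartition M q ((chartAt E3 q).symm y)
      * density g (chartAt E3 q) y * lieNormSq g X ((chartAt E3 q).symm y) = 0 := by
  have hat : ∀ p : M, chartAt E3 p ∈ IsManifold.maximalAtlas (𝓡 3) ∞ M :=
    fun p => IsManifold.chart_mem_maximalAtlas p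
  have h1 : ∀ q, ∫ y in (chartAt E3 q).target,
      fluxDeriv g X (chartAt E3 q) (chartPartition M q) y * density g (chartAt E3 q) y
      = ∑ p ∈ P, ∫ y in (chartAt E3 q).target, chartPartition M p ((chartAt E3 q).symm y)
        * fluxDeriv g X (chartAt E3 q) (chartPartition M q) y * density g (chartAt E3 q) y := by
    intro q
    rw [← integral_finsetSum]
    · refine setIntegral_congr_fun (chartAt E3 q).open_target.measurableSet fun y _ => ?_
      rw [← Finset.sum_mul, ← Finset.sum_mul, hP, one_mul]
    · intro p _
      refine integrableOn_of_compact (chartAt E3 q).open_target (isCompact_image_tsupport q)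
        (image_tsupport_subset q) ?_ fun y hy h => ?_
      · exact ((((chartPartition M p).contMDiff.continuous.comp_continuousOn
          (chartAt E3 q).continuousOn_symm).mul
          (contDiffOn_fluxDeriv g hX (hat q) (chartPartition M q).contMDiff).continuousOn).mul
          (contDiffOn_density g (hat q)).continuousOn)
      · rw [fluxDeriv_eq_zero g hy (symm_notMem_tsupport q hy h), mul_zero, zero_mul]
  have h2 : ∀ p, ∑ q ∈ P, ∫ y in (chartAt E3 p).target,
      chartPartition M p ((chartAt E3 p).symm y)
        * fluxDeriv g X (chartAt E3 p) (chartPartition M q) y * density g (chartAt E3 p) y = 0 := by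
    intro p
    rw [← integral_finsetSum]
    · rw [← integral_zero E3 ℝ (μ := volume.restrict (chartAt E3 p).target)]
      refine setIntegral_congr_fun (chartAt E3 p).open_target.measurableSet fun y hy => ?_
      rw [← Finset.sum_mul, ← Finset.mul_sum]
      have hd : ∀ q, DifferentiableAt ℝ (fun z => chartPartition M q ((chartAt E3 p).symm z)) y :=
        fun q => differentiableAt_of_contDiffOn (chartAt E3 p).open_target
          (contDiffOn_comp_symm (hat p) (chartPartition M q).contMDiff) hy
      have h3 : ∀ i, ∑ q ∈ P, pd i (fun z => chartPartition M q ((chartAt E3 p).symm z)) y = 0 := by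
        intro i
        have : (fun z => ∑ q ∈ P, chartPartition M q ((chartAt E3 p).symm z)) = fun _ => 1 :=
          funext fun z => hP _
        have h4 := fderiv_fun_sum (𝕜 := ℝ) (u := P) fun q _ => hd q
        rw [this, fderiv_const_apply] at h4
        have h5 := congrArg (fun L : E3 →L[ℝ] ℝ => L (EuclideanSpace.single i 1)) h4
        simpa [pd] using h5.symm
      have h4 : ∑ q ∈ P, fluxDeriv g X (chartAt E3 p) (chartPartition M q) y = 0 := by
        simp only [fluxDeriv]
        rw [Finset.sum_comm]
        simp only [← Finset.mul_sum, h3, mul_zero, Finset.sum_const_zero]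
      rw [h4, mul_zero, zero_mul]
    · intro q _
      have := integrableOn_partition_mul g p
        (contDiffOn_fluxDeriv g hX (hat p) (chartPartition M q).contMDiff).continuousOn
      refine this.congr_fun (fun y _ => ?_) (chartAt E3 p).open_target.measurableSet
      simp only; ring
  have h3 : ∀ q, ∫ y in (chartAt E3 q).target, chartPartition M q ((chartAt E3 q).symm y)
      * density g (chartAt E3 q) y * lieNormSq g X ((chartAt E3 q).symm y)
      = -2 * ∑ p ∈ P, ∫ y in (chartAt E3 p).target, chartPartition M p ((chartAt E3 p).symm y)
        * fluxDeriv g X (chartAt E3 p) (chartPartition M q) y * density g (chartAt E3 p) y := by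
    intro q
    rw [integral_mul_lieNormSq g hX hK (hat q) (chartPartition M q).contMDiff
      (isClosed_tsupport _).isCompact (tsupport_chartPartition q), h1]
    exact congrArg (-2 * ·) (Finset.sum_congr rfl fun p _ =>
      integral_partition_fluxDeriv g hX p q)
  simp only [h3, ← Finset.mul_sum]
  rw [Finset.sum_comm]
  simp only [h2, Finset.sum_const_zero, mul_zero]

/-- For a soliton `|ℒ_X g|²` vanishes at every point `q`: its integral is a vanishing sum of
non-negative terms, one of which has a weight `ρₚ` that is positive at `q`. -/
theorem lieNormSq_eq_zero
    (hX : ContMDiff (𝓡 3) (𝓡 3).tangent ∞ (fun x => (⟨x, X x⟩ : TangentBundle (𝓡 3) M)))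
    (hK : IsKSoliton g X) (q : M) : lieNormSq g X q = 0 := by
  obtain ⟨P, hP0, hP⟩ := exists_finset_chartPartition (M := M)
  have hat : ∀ p : M, chartAt E3 p ∈ IsManifold.maximalAtlas (𝓡 3) ∞ M :=
    fun p => IsManifold.chart_mem_maximalAtlas p
  have hn : ∀ p : M, ∀ y, 0 ≤ chartPartition M p ((chartAt E3 p).symm y)
      * density g (chartAt E3 p) y * lieNormSq g X ((chartAt E3 p).symm y) := fun p y =>
    mul_nonneg (mul_nonneg ((chartPartition M).nonneg _ _) (Real.sqrt_nonneg _))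
      (lieNormSq_nonneg g _)
  obtain ⟨p, hp, hpq⟩ : ∃ p ∈ P, chartPartition M p q ≠ 0 := by
    by_contra! h
    have := hP q
    rw [Finset.sum_eq_zero h] at this
    exact zero_ne_one this
  have hqs : q ∈ (chartAt E3 p).source :=
    tsupport_chartPartition p (subset_tsupport _ hpq)
  have h1 := (Finset.sum_eq_zero_iff_of_nonneg fun p _ => integral_nonneg (hn p)).1
    (sum_integral_eq_zero g hX hK hP) p hp
  have hcont := (continuous_lieNormSq g hX).comp_continuousOn (chartAt E3 p).continuousOn_symm
  have h2 := eqOn_zero_of_setIntegral_eq_zero (chartAt E3 p).open_target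
    ((((chartPartition M p).contMDiff.continuous.comp_continuousOn
      (chartAt E3 p).continuousOn_symm).mul (contDiffOn_density g (hat p)).continuousOn).mul hcont)
    (integrableOn_partition_mul g p hcont) (fun y _ => hn p y) h1
    ((chartAt E3 p).map_source hqs)
  have hd : density g (chartAt E3 p) (chartAt E3 p q) ≠ 0 := (Real.sqrt_pos.2
    (metricCoeff_posDef g (hat p) ((chartAt E3 p).map_source hqs)).det_pos).ne'
  change chartPartition M p ((chartAt E3 p).symm (chartAt E3 p q)) * density g (chartAt E3 p)
    (chartAt E3 p q) * lieNormSq g X ((chartAt E3 p).symm (chartAt E3 p q)) = 0 at h2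
  rw [(chartAt E3 p).left_inv hqs] at h2
  simpa [hpq, hd] using h2

end Compact

end KFlow

end

theorem mainTheorem4 {M : Type*} [TopologicalSpace M] [ChartedSpace KFlow.E3 M]
    [IsManifold (𝓡 3) ∞ M] [T2Space M] [CompactSpace M] [MeasurableSpace M] [BorelSpace M] :
    (∀ (g : KFlow.Metric M) (X : (x : M) → TangentSpace (𝓡 3) x),
      ContMDiff (𝓡 3) (𝓡 3).tangent ∞ (fun x => (⟨x, X x⟩ : TangentBundle (𝓡 3) M)) →
      KFlow.IsKSoliton g X →
        (Integrable (KFlow.lieNormSq g X) (KFlow.riemannianVolume g) ∧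
          ∫ p, KFlow.lieNormSq g X p ∂(KFlow.riemannianVolume g) = 0) ∧
        KFlow.IsKilling g X ∧ KFlow.KVanishes g) ∧
    (∀ g : KFlow.Metric M, KFlow.IsFlat g →
      KFlow.KVanishes g ∧
      ∀ X : (x : M) → TangentSpace (𝓡 3) x,
        ContMDiff (𝓡 3) (𝓡 3).tangent ∞ (fun x => (⟨x, X x⟩ : TangentBundle (𝓡 3) M)) →
        (KFlow.IsKSoliton g X ↔ KFlow.IsKilling g X)) := by
  refine ⟨fun g X hX hK => ?_, fun g hflat => ?_⟩
  · have hzero := KFlow.lieNormSq_eq_zero g hX hK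
    have hkill : KFlow.IsKilling g X := fun e he y hy => by
      refine (KFlow.normSq_nonneg_and_eq_zero (KFlow.metricCoeff_posDef g he hy) _).2 ?_
      rw [← KFlow.lieNormSq_symm_apply g hX he hy, hzero]
    obtain ⟨P, hP0, hP⟩ := KFlow.exists_finset_chartPartition (M := M)
    have hpiece := fun p => KFlow.integral_volumePiece g p (KFlow.continuous_lieNormSq g hX)
    refine ⟨?_, hkill, fun e he y hy => by rw [← hK e he y hy, hkill e he y hy]⟩
    rw [KFlow.riemannianVolume_eq_sum g hP0]
    refine ⟨integrable_finsetSum_measure.2 fun p _ => (hpiece p).1, ?_⟩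
    rw [integral_finsetSum_measure fun p _ => (hpiece p).1]
    simp only [fun p => (hpiece p).2]
    exact KFlow.sum_integral_eq_zero g hX hK hP
  · have hvan : KFlow.KVanishes g := fun e he y hy =>
      KFlow.tensorK_eq_zero_of_riemann e.open_target
        (fun i j k l z hz => hflat e he z hz i j k l) hy
    refine ⟨hvan, fun X _ => forall₂_congr fun e he => forall₂_congr fun y hy => ?_⟩
    rw [hvan e he y hy]
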